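/- Let $m\ge 1$, let $\mathcal S(\mathbb R^m)$ be the space of complex-valued Schwartz functions, and put $\lambda=(m-2)/2$. For $k\in\mathbb Z_{\ge0}$ let $\mathcal H_k$ be the space of homogeneous polynomials of degree $k$ with complex coefficients in $m$ variables that are annihilated by the Laplace operator $\Delta$, and let $\{H_k^{(\ell)}\}_\ell$ be a basis of $\mathcal H_k$. For $j,k\in\mathbb Z_{\ge0}$ and each $\ell$ let $$\phi_{j,k,\ell}(x)=2^j\,j!\,L_j^{\frac m2+k-1}(|x|^2)\,H_k^{(\ell)}(x)\,e^{-|x|^2/2},$$ where $L_j^\alpha$ is the generalized Laguerre polynomial. Let $T:\mathcal S(\mathbb R^m)\to\mathcal S(\mathbb R^m)$ be a linear operator (not assumed to be continuous) such that (i) (Helmholtz relations) $T\circ\Delta_x=-|y|^2\circ T$ and $T\circ|x|^2=-\Delta_y\circ T$ on $\mathcal S(\mathbb R^m)$; (ii) there are $\mu_{j,k}\in\mathbb C$ with $T\phi_{j,k,\ell}=\mu_{j,k}\,\phi_{j,k,\ell}$ for all $j,k,\ell$. Then, with $z=|x||y|$ and $w=\langle x,y\rangle/z$, the series $$K_m(x,y)=2^{\lambda}\,\Gamma(\lambda)\sum_{k=0}^{\infty}(k+\lambda)\,\mu_{0,k}\,z^{-\lambda}J_{k+\lambda}(z)\,C_k^{\lambda}(w)$$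 converges absolutely for all $x,y\in\mathbb R^m$, and for all $j,k,\ell$ and all $y\in\mathbb R^m$ the function $x\mapsto K_m(x,y)\,\phi_{j,k,\ell}(x)$ is integrable and $$(T\phi_{j,k,\ell})(y)=\frac1{(2\pi)^{m/2}}\int_{\mathbb R^m}K_m(x,y)\,\phi_{j,k,\ell}(x)\,\mathrm dx .$$ Here $J_\nu(t)=\sum_{n\ge0}\frac{(-1)^n}{n!\,\Gamma(n+\nu+1)}\left(\frac t2\right)^{2n+\nu}$ is the Bessel function and $C_k^\lambda(w)=\sum_{j=0}^{\lfloor k/2\rfloor}(-1)^j\frac{\Gamma(k-j+\lambda)}{\Gamma(\lambda)\,j!\,(k-2j)!}(2w)^{k-2j}$ is the Gegenbauer polynomial. At $z=0$ the factor $z^{-\lambda}J_{k+\lambda}(z)$ is extended by continuity and the value of $w$ is irrelevant (it is taken to be $0$); for $m=2$, that is $\lambda=0$, the product $\Gamma(\lambda)(k+\lambda)C_k^\lambda(w)$ is understood as its limit for $\lambda\to0$. (In dimension $m=1$, where $\mathcal H_k=0$ for $k\ge2$, the numbers $\mu_{0,k}$ with $k\ge2$ are arbitrary and do not influence $K_1$.)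 -/

import Mathlib

open scoped SchwartzMap Laplacian ContDiff Nat Topology

noncomputable section

namespace HelmholtzFourier

/-! ## Special functions -/

/-- The generalized Laguerre polynomial `L_j^α`, for `α > -1`. -/
def laguerre (j : ℕ) (α t : ℝ) : ℝ :=
  ∑ n ∈ Finset.range (j + 1),
    Real.Gamma (j + α + 1) / ((n ! : ℝ) * ((j - n)! : ℝ) * Real.Gamma (n + α + 1)) * (-t) ^ n

/-- The Gegenbauer polynomial `C_k^lam`, for `lam` not a pole of the Gamma function. -/
def gegenbauer (k : ℕ) (lam w : ℝ) : ℝ :=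
  ∑ j ∈ Finset.range (k / 2 + 1),
    (-1) ^ j * Real.Gamma (k - j + lam) / (Real.Gamma lam * (j ! : ℝ) * ((k - 2 * j)! : ℝ))
      * (2 * w) ^ (k - 2 * j)

/-- The Bessel function `J_ν(t)` for `t > 0`, by its power series. -/
def besselJ (ν t : ℝ) : ℝ :=
  ∑' n : ℕ, (-1) ^ n / ((n ! : ℝ) * Real.Gamma (n + ν + 1)) * (t / 2) ^ (2 * (n : ℝ) + ν)

/-- The function `z ↦ z^(-lam) J_{k+lam}(z)` on `[0, ∞)`. At `z = 0` it is defined by continuity,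
see `tendsto_besselQuot`. -/
def besselQuot (k : ℕ) (lam z : ℝ) : ℝ :=
  if z = 0 then (if k = 0 then 1 / (2 ^ lam * Real.Gamma (lam + 1)) else 0)
  else z ^ (-lam) * besselJ (k + lam) z

/-- The product `Γ(lam) (k + lam) C_k^lam(w)`. For `lam = 0`, where `Γ` has a pole, it is the limit
for `lam → 0`, see `tendsto_gammaGegenbauer`. -/
def gammaGegenbauer (k : ℕ) (lam w : ℝ) : ℝ :=
  if lam = 0 then
    (if k = 0 then 1 else
      k * ∑ j ∈ Finset.range (k / 2 + 1),
        (-1) ^ j * Real.Gamma (k - j) / ((j ! : ℝ) * ((k - 2 * j)! : ℝ)) * (2 * w) ^ (k - 2 * j))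
  else Real.Gamma lam * (k + lam) * gegenbauer k lam w

/-! ## Hermite functions -/

/-- The Euclidean space `ℝ^m`. -/
abbrev E (m : ℕ) : Type := EuclideanSpace ℝ (Fin m)

/-- The Laplace operator on (complex) polynomials in `m` variables. -/
def polyLaplacian (m : ℕ) : MvPolynomial (Fin m) ℂ →ₗ[ℂ] MvPolynomial (Fin m) ℂ :=
  ∑ i : Fin m, (MvPolynomial.pderiv i).toLinearMap ∘ₗ (MvPolynomial.pderiv i).toLinearMap

/-- The space `H_k` of spherical harmonics of degree `k`: homogeneous polynomials of degree `k`
which are null-solutions of the Laplace operator. -/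
def sphericalHarmonics (m k : ℕ) : Submodule ℂ (MvPolynomial (Fin m) ℂ) :=
  MvPolynomial.homogeneousSubmodule (Fin m) ℂ k ⊓ LinearMap.ker (polyLaplacian m)

theorem gaussian_contDiff (m : ℕ) :
    ContDiff ℝ ∞ (fun x : E m => Real.exp (-‖x‖ ^ 2 / 2)) :=
  (((contDiff_norm_sq ℝ).neg).div_const 2).exp

theorem gaussian_decay (m k n : ℕ) : ∃ C : ℝ, ∀ x : E m,
    ‖x‖ ^ k * ‖iteratedFDeriv ℝ n (fun x : E m => Real.exp (-‖x‖ ^ 2 / 2)) x‖ ≤ C := by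
  have hq : (fun x : E m => -‖x‖ ^ 2 / 2).HasTemperateGrowth := by
    have h := (Function.HasTemperateGrowth.const (E := E m) (-1 / 2 : ℝ)).mul
      (Function.hasTemperateGrowth_norm_sq (E m))
    have e : (fun x : E m => -‖x‖ ^ 2 / 2) = (fun _ => (-1 / 2 : ℝ)) * fun x : E m => ‖x‖ ^ 2 := by
      funext x
      simp only [Pi.mul_apply]
      ring
    rw [e]
    exact h
  obtain ⟨N, C, hC, hD⟩ := hq.norm_iteratedFDeriv_le_uniform n
  obtain ⟨B, hB⟩ : ∃ B : ℝ, ∀ t : ℝ, 0 ≤ t →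
      t ^ k * (1 + t) ^ (N * n) * Real.exp (-t ^ 2 / 2) ≤ B := by
    refine ⟨((k + N * n)! : ℝ) * Real.exp 1 * Real.exp 2, fun t ht => ?_⟩
    have h1 : t ^ k * (1 + t) ^ (N * n) ≤ (1 + t) ^ (k + N * n) := by
      rw [pow_add]
      gcongr
      linarith
    have h2 : (1 + t) ^ (k + N * n) ≤ ((k + N * n)! : ℝ) * Real.exp (1 + t) := by
      have := Real.pow_div_factorial_le_exp (1 + t) (by linarith) (k + N * n)
      rw [div_le_iff₀ (by positivity)] at this
      linarith
    calc t ^ k * (1 + t) ^ (N * n) * Real.exp (-t ^ 2 / 2)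
        ≤ ((k + N * n)! : ℝ) * Real.exp (1 + t) * Real.exp (-t ^ 2 / 2) := by
          exact mul_le_mul_of_nonneg_right (h1.trans h2) (Real.exp_pos _).le
      _ = ((k + N * n)! : ℝ) * Real.exp 1 * Real.exp (t + -t ^ 2 / 2) := by
          rw [Real.exp_add, Real.exp_add]
          ring
      _ ≤ _ := by
          gcongr
          nlinarith [sq_nonneg (t - 1)]
  refine ⟨n ! * (C + 1) ^ n * B, fun x => ?_⟩
  have key := norm_iteratedFDeriv_comp_le (n := n) (N := ∞) (g := Real.exp)
    (f := fun x : E m => -‖x‖ ^ 2 / 2) Real.contDiff_exp hq.1 (mod_cast le_top) x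
    (C := Real.exp (-‖x‖ ^ 2 / 2)) (D := (C + 1) * (1 + ‖x‖) ^ N) (by
      intro i _
      rw [norm_iteratedFDeriv_eq_norm_iteratedDeriv, iteratedDeriv_eq_iterate,
        Real.iter_deriv_exp, Real.norm_eq_abs, abs_of_pos (Real.exp_pos _)]) (by
      intro i hi hin
      refine (hD i hin x).trans ?_
      have h1 : C * (1 + ‖x‖) ^ N ≤ (C + 1) * (1 + ‖x‖) ^ N := by
        gcongr
        linarith
      refine h1.trans (le_self_pow₀ ?_ (by omega))
      have : (1 : ℝ) ≤ (1 + ‖x‖) ^ N := one_le_pow₀ (by linarith [norm_nonneg x])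
      nlinarith)
  calc ‖x‖ ^ k * ‖iteratedFDeriv ℝ n (fun x : E m => Real.exp (-‖x‖ ^ 2 / 2)) x‖
      ≤ ‖x‖ ^ k * (n ! * Real.exp (-‖x‖ ^ 2 / 2) * ((C + 1) * (1 + ‖x‖) ^ N) ^ n) := by
        gcongr
        exact key
    _ = n ! * (C + 1) ^ n * (‖x‖ ^ k * (1 + ‖x‖) ^ (N * n) * Real.exp (-‖x‖ ^ 2 / 2)) := by
        rw [mul_pow, ← pow_mul]
        ring
    _ ≤ _ := by
        gcongr
        exact hB _ (norm_nonneg x)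

/-- The Gaussian `exp(-|x|²/2)` as a Schwartz function. -/
def gaussian (m : ℕ) : 𝓢(E m, ℝ) where
  toFun x := Real.exp (-‖x‖ ^ 2 / 2)
  smooth' := gaussian_contDiff m
  decay' := gaussian_decay m

/-- The Hermite function
`φ(x) = 2^j j! L_j^{m/2+k-1}(|x|²) H(x) exp(-|x|²/2)` as a function on `ℝ^m`. -/
def hermiteFun (m j k : ℕ) (H : MvPolynomial (Fin m) ℂ) (x : E m) : ℂ :=
  2 ^ j * (j ! : ℂ) * (laguerre j ((m : ℝ) / 2 + k - 1) (‖x‖ ^ 2) : ℂ)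
    * MvPolynomial.eval (fun i => (x i : ℂ)) H * (Real.exp (-‖x‖ ^ 2 / 2) : ℂ)

theorem temperate_coord (m : ℕ) (i : Fin m) :
    (fun x : E m => (x i : ℂ)).HasTemperateGrowth :=
  (Complex.ofRealCLM.comp (EuclideanSpace.proj (𝕜 := ℝ) i)).hasTemperateGrowth

theorem temperate_eval (m : ℕ) (H : MvPolynomial (Fin m) ℂ) :
    (fun x : E m => MvPolynomial.eval (fun i => (x i : ℂ)) H).HasTemperateGrowth := by
  induction H using MvPolynomial.induction_on with
  | C a => simp
  | add p q hp hq => simpa using! hp.add hq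
  | mul_X p i hp => simpa using! hp.mul (temperate_coord m i)

theorem temperate_laguerre (m j : ℕ) (α : ℝ) :
    (fun x : E m => laguerre j α (‖x‖ ^ 2)).HasTemperateGrowth := by
  unfold laguerre
  refine Function.HasTemperateGrowth.sum fun n _ => ?_
  exact (Function.HasTemperateGrowth.const _).mul
    ((Function.hasTemperateGrowth_norm_sq (E m)).neg.pow n)

theorem hermiteFun_eq (m j k : ℕ) (H : MvPolynomial (Fin m) ℂ) :
    ∃ f : 𝓢(E m, ℂ), (f : E m → ℂ) = hermiteFun m j k H := by
  have hg : (fun x : E m => 2 ^ j * (j ! : ℂ) *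
      (laguerre j ((m : ℝ) / 2 + k - 1) (‖x‖ ^ 2) : ℂ)
        * MvPolynomial.eval (fun i => (x i : ℂ)) H).HasTemperateGrowth :=
    ((Function.HasTemperateGrowth.const (2 ^ j * (j ! : ℂ))).mul
      (Function.HasTemperateGrowth.comp Function.Complex.hasTemperateGrowth_ofReal
        (temperate_laguerre m j ((m : ℝ) / 2 + k - 1)))).mul (temperate_eval m H)
  refine ⟨SchwartzMap.smulLeftCLM ℂ (fun x : E m => 2 ^ j * (j ! : ℂ) *
      (laguerre j ((m : ℝ) / 2 + k - 1) (‖x‖ ^ 2) : ℂ)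
        * MvPolynomial.eval (fun i => (x i : ℂ)) H)
    (SchwartzMap.postcompCLM (𝕜 := ℝ) Complex.ofRealCLM (gaussian m)), ?_⟩
  exact SchwartzMap.smulLeftCLM_apply hg _

/-- The Hermite function `φ_{j,k}` built on a polynomial `H` (a spherical harmonic of degree `k`),
as an element of the Schwartz space. -/
def hermite (m j k : ℕ) (H : MvPolynomial (Fin m) ℂ) : 𝓢(E m, ℂ) where
  toFun := hermiteFun m j k H
  smooth' := by
    obtain ⟨f, hf⟩ := hermiteFun_eq m j k H
    exact hf ▸ f.smooth'
  decay' := by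
    obtain ⟨f, hf⟩ := hermiteFun_eq m j k H
    exact hf ▸ f.decay'

/-! ## The Helmholtz relations -/

/-- Multiplication by `|x|²` on the Schwartz space. -/
def normSqMul (m : ℕ) : 𝓢(E m, ℂ) →L[ℝ] 𝓢(E m, ℂ) :=
  SchwartzMap.smulLeftCLM ℂ (fun x : E m => ‖x‖ ^ 2)

theorem normSqMul_apply (m : ℕ) (f : 𝓢(E m, ℂ)) (x : E m) :
    normSqMul m f x = ((‖x‖ ^ 2 : ℝ) : ℂ) * f x := by
  simp [normSqMul, SchwartzMap.smulLeftCLM_apply_apply (Function.hasTemperateGrowth_norm_sq (E m))]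

/-- The Helmholtz relations `T ∘ Δ = -|y|² ∘ T` and `T ∘ |x|² = -Δ ∘ T`. -/
def HelmholtzRelations {m : ℕ} (T : 𝓢(E m, ℂ) →ₗ[ℂ] 𝓢(E m, ℂ)) : Prop :=
  (∀ f : 𝓢(E m, ℂ), T (Δ f) = -normSqMul m (T f)) ∧
    ∀ f : 𝓢(E m, ℂ), T (normSqMul m f) = -Δ (T f)

/-! ## The kernel -/

/-- `λ = (m - 2) / 2`. -/
def lam (m : ℕ) : ℝ := ((m : ℝ) - 2) / 2

/-- The `k`-th term `2^λ Γ(λ) (k + λ) μ_k z^(-λ) J_{k+λ}(z) C_k^λ(w)` of the kernel, with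
`z = |x||y|` and `w = ⟨x,y⟩ / z`. -/
def kernelTerm (m : ℕ) (μ : ℕ → ℂ) (x y : E m) (k : ℕ) : ℂ :=
  ((2 ^ lam m * gammaGegenbauer k (lam m) (inner ℝ x y / (‖x‖ * ‖y‖))
    * besselQuot k (lam m) (‖x‖ * ‖y‖) : ℝ) : ℂ) * μ k

/-- The kernel `K_m(x,y)` with coefficients `μ_k`. -/
def kernel (m : ℕ) (μ : ℕ → ℂ) (x y : E m) : ℂ :=
  ∑' k : ℕ, kernelTerm m μ x y k

/-! ## The values defined by continuity -/

/-- The value of `gammaGegenbauer` at `lam = 0` is the limit of `Γ(l) (k + l) C_k^l(w)`. -/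
theorem tendsto_gammaGegenbauer (k : ℕ) (w : ℝ) :
    Filter.Tendsto (fun l : ℝ => Real.Gamma l * (k + l) * gegenbauer k l w) (𝓝[≠] 0)
      (𝓝 (gammaGegenbauer k 0 w)) := by
  have hne : ∀ᶠ l : ℝ in 𝓝[≠] 0, l ≠ 0 ∧ Real.Gamma l ≠ 0 := by
    have h1 : ∀ᶠ l : ℝ in 𝓝[≠] 0, -1 < l :=
      nhdsWithin_le_nhds (lt_mem_nhds (by norm_num))
    filter_upwards [h1, self_mem_nhdsWithin] with l hl hl0
    refine ⟨hl0, Real.Gamma_ne_zero fun n hn => ?_⟩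
    rcases Nat.eq_zero_or_pos n with rfl | hn0
    · simp at hn
      exact hl0 hn
    · have : (1 : ℝ) ≤ n := by exact_mod_cast hn0
      linarith
  rcases Nat.eq_zero_or_pos k with rfl | hk
  · have hc : Filter.Tendsto (fun l : ℝ => Real.Gamma (l + 1)) (𝓝[≠] 0) (𝓝 1) := by
      have h : ContinuousAt (fun l : ℝ => Real.Gamma (l + 1)) 0 := by
        refine ContinuousAt.comp (f := fun l : ℝ => l + 1) (g := Real.Gamma) ?_ (by fun_prop)
        refine (Real.differentiableAt_Gamma fun n => ?_).continuousAt
        have : (0 : ℝ) ≤ n := n.cast_nonneg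
        intro h
        simp only [zero_add] at h
        linarith
      have h' := h.tendsto.mono_left (nhdsWithin_le_nhds (s := {(0 : ℝ)}ᶜ))
      simpa using h'
    simp only [gammaGegenbauer, if_true]
    refine hc.congr' ?_
    filter_upwards [hne] with l hl
    rw [Real.Gamma_add_one hl.1]
    simp [gegenbauer, hl.2]
    ring
  · have hc : ContinuousAt (fun l : ℝ => ((k : ℝ) + l) * ∑ j ∈ Finset.range (k / 2 + 1),
        (-1) ^ j * Real.Gamma (k - j + l) / ((j ! : ℝ) * ((k - 2 * j)! : ℝ))
          * (2 * w) ^ (k - 2 * j)) 0 := by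
      refine ContinuousAt.mul (f := fun l : ℝ => (k : ℝ) + l) (by fun_prop) ?_
      refine tendsto_finsetSum (Finset.range (k / 2 + 1)) fun j hj => ?_
      have hG : ContinuousAt (fun l : ℝ => Real.Gamma ((k : ℝ) - j + l)) 0 := ?_
      · exact ((hG.const_mul _).div_const _).mul_const _
      refine ContinuousAt.comp (f := fun l : ℝ => (k : ℝ) - j + l) (g := Real.Gamma) ?_
        (by fun_prop)
      refine (Real.differentiableAt_Gamma fun n => ?_).continuousAt
      have hjk : j < k := by
        have := Finset.mem_range.1 hj
        omega
      have h1 : (j : ℝ) < k := by exact_mod_cast hjk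
      have h2 : (0 : ℝ) ≤ n := n.cast_nonneg
      intro h
      linarith
    have h' := hc.tendsto.mono_left (nhdsWithin_le_nhds (s := {(0 : ℝ)}ᶜ))
    simp only [add_zero] at h'
    simp only [gammaGegenbauer, if_true, hk.ne', if_false]
    refine h'.congr' ?_
    filter_upwards [hne] with l hl
    rw [gegenbauer, mul_comm (Real.Gamma l), mul_assoc]
    refine congrArg _ ?_
    rw [Finset.mul_sum]
    refine Finset.sum_congr rfl fun j _ => ?_
    have h3 := hl.2
    field_simp

theorem besselQuot_series (k : ℕ) (lam z : ℝ) (hz : 0 < z) :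
    z ^ (-lam) * besselJ (k + lam) z = 2 ^ (-lam) * (z / 2) ^ k * ∑' n : ℕ,
      (-1) ^ n / ((n ! : ℝ) * Real.Gamma (n + (k + lam) + 1)) * (z / 2) ^ (2 * n) := by
  rw [besselJ, ← tsum_mul_left, ← tsum_mul_left]
  refine tsum_congr fun n => ?_
  have h2 : 0 < z / 2 := by positivity
  have e : (2 * (n : ℝ) + (k + lam)) = ((2 * n + k : ℕ) : ℝ) + lam := by
    push_cast
    ring
  have hz2 : z ^ (-lam) = 2 ^ (-lam) * (z / 2) ^ (-lam) := by
    rw [← Real.mul_rpow (by norm_num) h2.le]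
    congr 1
    ring
  rw [e, Real.rpow_add h2, Real.rpow_natCast, pow_add, hz2, Real.rpow_neg h2.le]
  have : (z / 2) ^ lam ≠ 0 := (Real.rpow_pos_of_pos h2 _).ne'
  field_simp

/-- The value of `besselQuot` at `z = 0` is the limit of `z^(-lam) J_{k+lam}(z)`. -/
theorem tendsto_besselQuot (k : ℕ) (lam : ℝ) (hlam : -1 < lam) :
    Filter.Tendsto (fun z : ℝ => z ^ (-lam) * besselJ (k + lam) z) (𝓝[>] 0)
      (𝓝 (besselQuot k lam 0)) := by
  set a : ℝ := k + lam + 1 with ha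
  have ha0 : 0 < a := by
    have : (0 : ℝ) ≤ k := k.cast_nonneg
    linarith
  obtain ⟨c, hc0, hc⟩ : ∃ c : ℝ, 0 < c ∧ ∀ n : ℕ, c ≤ Real.Gamma (n + (k + lam) + 1) := by
    refine ⟨min (Real.Gamma a) (Real.Gamma (a + 1)), lt_min (Real.Gamma_pos_of_pos ha0)
      (Real.Gamma_pos_of_pos (by linarith)), fun n => ?_⟩
    rcases n with _ | n
    · refine (min_le_left _ _).trans (le_of_eq ?_)
      congr 1
      push_cast
      ring
    · refine (min_le_right _ _).trans ?_
      induction n with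
      | zero =>
        refine le_of_eq ?_
        congr 1
        push_cast
        ring
      | succ n ih =>
        refine ih.trans ?_
        have hpos : 0 < ((n + 1 : ℕ) : ℝ) + (k + lam) + 1 := by
          push_cast
          have : (0 : ℝ) ≤ n := n.cast_nonneg
          linarith
        have e : ((n + 1 + 1 : ℕ) : ℝ) + (k + lam) + 1
            = (((n + 1 : ℕ) : ℝ) + (k + lam) + 1) + 1 := by
          push_cast
          ring
        rw [e, Real.Gamma_add_one hpos.ne']
        refine le_mul_of_one_le_left (Real.Gamma_pos_of_pos hpos).le ?_
        push_cast
        have : (0 : ℝ) ≤ n := n.cast_nonneg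
        linarith
  have hcont : ContinuousOn (fun z : ℝ => ∑' n : ℕ,
      (-1) ^ n / ((n ! : ℝ) * Real.Gamma (n + (k + lam) + 1)) * (z / 2) ^ (2 * n))
      (Set.Icc (-1) 1) := by
    refine continuousOn_tsum (u := fun n : ℕ => 1 / c * (1 ^ n / (n ! : ℝ))) (fun n => ?_)
      ((Real.summable_pow_div_factorial 1).mul_left _) ?_
    · fun_prop
    · intro n z hz
      have hz1 : |z / 2| ≤ 1 := by
        rw [abs_le]
        constructor <;> linarith [hz.1, hz.2]
      have hG : 0 < Real.Gamma (n + (k + lam) + 1) := hc0.trans_le (hc n)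
      rw [norm_mul, norm_div, norm_pow, norm_pow, norm_neg, norm_one, one_pow, norm_mul,
        Real.norm_eq_abs (Real.Gamma _), abs_of_pos hG, Real.norm_eq_abs (z / 2), RCLike.norm_natCast]
      calc 1 / ((n ! : ℝ) * Real.Gamma (n + (k + lam) + 1)) * |z / 2| ^ (2 * n)
          ≤ 1 / ((n ! : ℝ) * c) * 1 := by
            gcongr
            · exact hc n
            · exact pow_le_one₀ (abs_nonneg _) hz1
        _ = 1 / c * (1 / (n ! : ℝ)) := by
            field_simp
        _ = _ := by
            norm_num
  have h0 : ContinuousAt (fun z : ℝ => 2 ^ (-lam) * (z / 2) ^ k * ∑' n : ℕ,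
      (-1) ^ n / ((n ! : ℝ) * Real.Gamma (n + (k + lam) + 1)) * (z / 2) ^ (2 * n)) 0 :=
    ContinuousAt.mul (by fun_prop)
      (hcont.continuousAt (Icc_mem_nhds (by norm_num) (by norm_num)))
  have h1 := h0.tendsto.mono_left (nhdsWithin_le_nhds (s := Set.Ioi 0))
  have hv : (2 : ℝ) ^ (-lam) * (0 / 2) ^ k * ∑' n : ℕ,
      (-1) ^ n / ((n ! : ℝ) * Real.Gamma (n + (k + lam) + 1)) * ((0 : ℝ) / 2) ^ (2 * n)
      = besselQuot k lam 0 := by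
    rw [besselQuot, if_pos rfl]
    rcases Nat.eq_zero_or_pos k with rfl | hk
    · rw [tsum_eq_single 0 (fun n hn => by simp [hn])]
      simp [Real.rpow_neg]
      ring
    · simp [hk.ne']
  rw [hv] at h1
  refine h1.congr' ?_
  filter_upwards [self_mem_nhdsWithin] with z hz
  exact (besselQuot_series k lam z hz).symm

end HelmholtzFourier

end

noncomputable section

namespace HelmholtzFourier

open MvPolynomial MeasureTheory
open scoped LineDeriv

/-! ## Harmonic polynomials and the Gaussian functional -/

/-! Put β = m/2 + k and let H be harmonic of degree k. Every Hermite function is a finite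
combination of functions |x|^{2n} H e^{-|x|²/2}, so both sides are compared on these, by linearity.

Operator side: the relation T ∘ |x|² = -Δ ∘ T gives T(|x|^{2n} H e^{-|x|²/2}) = μ_{0,k} (-Δ)^n (H
e^{-|x|²/2}). An induction on n evaluates this as μ_{0,k} q_n(|y|²) H e^{-|y|²/2} with explicit q_n
(`laplacian_radialMul`, `map_polyGaussian_sqNorm_pow`).

Kernel side: the factor z^k from the Bessel function turns C_k^λ(w) into a zonal harmonic polynomial
in x, and what remains is a power series in |x|²|y|² (`kernelTerm_eq`). Term by term the integrals
are Gaussian moments. They are computed algebraically from the rule I(x_i p) = I(∂_i p), which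
yields orthogonality of different degrees and the reproducing property of zonal harmonics. The Gamma
factors leave a series that sums to q_n(|y|²) e^{-|y|²/2} by a Chu–Vandermonde identity
(`hasSum_radialCoeff`, `integral_kernelTerm_mul`).

Summing over the degrees needs a bound on μ_{0,k}, although T is not assumed continuous. For m ≥ 2,
take y isotropic (∑ y_i² = 0) and apply T to the single Schwartz function f = G(⟨x,y⟩) e^{-|x|²/2},
where G(s) = e^{as}. Since T commutes with the oscillator |x|² - Δ, and f minus its degree N
component lies in the range of |x|² - Δ - (m + 2N), pairing T f with a harmonic polynomial of degree
N times the Gaussian isolates μ_{0,N} a^N/N! (`integral_map_expTypeGaussian`). As T f is integrable,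
this gives μ_{0,N} b^N = O(√N!) for every b > 0 (`slowGrowth_of_helmholtz`). That suffices, because
the k-th kernel term carries a factor 1/k!: one √k! absorbs the eigenvalue, and the other turns
powers of |x| into e^{|x|²/4}, which the Gaussian still dominates. For m = 1 only the degrees 0 and
1 occur. -/

theorem polyLaplacian_apply {m : ℕ} (p : MvPolynomial (Fin m) ℂ) :
    polyLaplacian m p = ∑ i, pderiv i (pderiv i p) := by
  simp [polyLaplacian]

theorem polyLaplacian_mul {m : ℕ} (p q : MvPolynomial (Fin m) ℂ) :
    polyLaplacian m (p * q) = polyLaplacian m p * q + 2 * ∑ i, pderiv i p * pderiv i q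
      + p * polyLaplacian m q := by
  simp only [polyLaplacian_apply, Finset.sum_mul, Finset.mul_sum, ← Finset.sum_add_distrib]
  refine Finset.sum_congr rfl fun i _ => ?_
  rw [pderiv_mul, map_add, pderiv_mul, pderiv_mul]
  ring

/-- The polynomial `∑ X_i²`. -/
def sqNorm (m : ℕ) : MvPolynomial (Fin m) ℂ := ∑ i, X i ^ 2

/-- The linear form with coefficients `y`. -/
def linForm {m : ℕ} (y : Fin m → ℂ) : MvPolynomial (Fin m) ℂ := ∑ i, C (y i) * X i

theorem pderiv_sqNorm {m : ℕ} (i : Fin m) : pderiv i (sqNorm m) = 2 * X i := by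
  classical
  simp [sqNorm, pderiv_X, Pi.single_apply, mul_comm]

theorem pderiv_linForm {m : ℕ} (y : Fin m → ℂ) (i : Fin m) :
    pderiv i (linForm y) = C (y i) := by
  classical
  simp [linForm, pderiv_X, Pi.single_apply]

theorem isHomogeneous_sqNorm (m : ℕ) : (sqNorm m).IsHomogeneous 2 :=
  IsHomogeneous.sum _ _ _ fun i _ => (isHomogeneous_X ℂ i).pow 2

theorem isHomogeneous_linForm {m : ℕ} (y : Fin m → ℂ) : (linForm y).IsHomogeneous 1 :=
  IsHomogeneous.sum _ _ _ fun i _ => by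
    simpa using (isHomogeneous_C (Fin m) (y i)).mul (isHomogeneous_X ℂ i)

theorem isHomogeneous_sqNorm_pow_mul {m k : ℕ} (n : ℕ) {p : MvPolynomial (Fin m) ℂ}
    (hp : p.IsHomogeneous k) : (sqNorm m ^ n * p).IsHomogeneous (2 * n + k) :=
  ((isHomogeneous_sqNorm m).pow n).mul hp

theorem sum_X_mul_pderiv' {m k : ℕ} {p : MvPolynomial (Fin m) ℂ} (hp : p.IsHomogeneous k) :
    ∑ i, X i * pderiv i p = (k : MvPolynomial (Fin m) ℂ) * p := by
  rw [hp.sum_X_mul_pderiv, nsmul_eq_mul]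

theorem polyLaplacian_sqNorm_mul {m k : ℕ} {p : MvPolynomial (Fin m) ℂ}
    (hp : p.IsHomogeneous k) :
    polyLaplacian m (sqNorm m * p)
      = ((2 * m + 4 * k : ℕ) : MvPolynomial (Fin m) ℂ) * p + sqNorm m * polyLaplacian m p := by
  have h1 : polyLaplacian m (sqNorm m) = ((2 * m : ℕ) : MvPolynomial (Fin m) ℂ) := by
    rw [polyLaplacian_apply]
    have : ∀ i : Fin m, pderiv i (pderiv i (sqNorm m)) = 2 := fun i => by
      rw [pderiv_sqNorm, pderiv_mul, pderiv_X_self]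
      have : pderiv i (2 : MvPolynomial (Fin m) ℂ) = 0 := by
        rw [← map_ofNat (C : ℂ →+* MvPolynomial (Fin m) ℂ) 2]; exact pderiv_C
      simp [this]
    simp [this, mul_comm]
  have h2 : ∑ i, pderiv i (sqNorm m) * pderiv i p = 2 * (k * p) := by
    rw [← sum_X_mul_pderiv' hp, Finset.mul_sum]
    refine Finset.sum_congr rfl fun i _ => ?_
    rw [pderiv_sqNorm]
    ring
  rw [polyLaplacian_mul, h1, h2]
  push_cast
  ring

/-- Each factor |x|² is peeled off with `polyLaplacian_sqNorm_mul`; the degree of the remaining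
factor grows by 2 at each step, and the constants add up to 2(n+1)(2n+2k+m). -/
theorem polyLaplacian_sqNorm_pow_mul {m k : ℕ} (n : ℕ) {p : MvPolynomial (Fin m) ℂ}
    (hp : p.IsHomogeneous k) :
    polyLaplacian m (sqNorm m ^ (n + 1) * p)
      = ((2 * (n + 1) * (2 * n + 2 * k + m) : ℕ) : MvPolynomial (Fin m) ℂ) * (sqNorm m ^ n * p)
        + sqNorm m ^ (n + 1) * polyLaplacian m p := by
  induction n with
  | zero =>
    rw [zero_add, pow_one, polyLaplacian_sqNorm_mul hp]
    push_cast
    ring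
  | succ n ih =>
    rw [pow_succ', mul_assoc, polyLaplacian_sqNorm_mul (isHomogeneous_sqNorm_pow_mul (n + 1) hp),
      ih]
    push_cast
    ring

theorem polyLaplacian_linForm_pow {m : ℕ} (y : Fin m → ℂ) (a : ℕ) :
    polyLaplacian m (linForm y ^ a)
      = C ((a : ℂ) * ((a - 1 : ℕ) : ℂ) * ∑ i, y i ^ 2) * linForm y ^ (a - 2) := by
  rw [polyLaplacian_apply, Finset.mul_sum, map_sum, Finset.sum_mul]
  refine Finset.sum_congr rfl fun i _ => ?_
  rw [pderiv_pow, pderiv_linForm, mul_comm, pderiv_C_mul, ← map_natCast C, pderiv_C_mul,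
    pderiv_pow, pderiv_linForm, ← map_natCast C]
  simp only [map_mul, map_pow, Nat.sub_sub]
  ring

theorem pderiv_eq_zero_of_isHomogeneous_zero {m : ℕ} {p : MvPolynomial (Fin m) ℂ}
    (hp : p.IsHomogeneous 0) (i : Fin m) : pderiv i p = 0 := by
  rw [totalDegree_eq_zero_iff_eq_C.1 ((totalDegree_zero_iff_isHomogeneous _).2 hp), pderiv_C]

theorem mem_sphericalHarmonics {m k : ℕ} {p : MvPolynomial (Fin m) ℂ} :
    p ∈ sphericalHarmonics m k ↔ p.IsHomogeneous k ∧ polyLaplacian m p = 0 := by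
  simp [sphericalHarmonics, mem_homogeneousSubmodule]

theorem pderiv_comm {m : ℕ} (a b : Fin m) (p : MvPolynomial (Fin m) ℂ) :
    pderiv a (pderiv b p) = pderiv b (pderiv a p) := by
  classical
  have h : ⁅pderiv (R := ℂ) a, pderiv (R := ℂ) b⁆ = 0 := by
    refine MvPolynomial.derivation_ext fun i => ?_
    rw [Derivation.commutator_apply, pderiv_X, pderiv_X]
    rcases eq_or_ne i a with rfl | ha <;> rcases eq_or_ne i b with rfl | hb <;> simp_all
  have := DFunLike.congr_fun h p
  rw [Derivation.commutator_apply, Derivation.zero_apply, sub_eq_zero] at this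
  exact this

theorem polyLaplacian_pderiv {m : ℕ} (i : Fin m) (p : MvPolynomial (Fin m) ℂ) :
    polyLaplacian m (pderiv i p) = pderiv i (polyLaplacian m p) := by
  simp only [polyLaplacian_apply, map_sum]
  refine Finset.sum_congr rfl fun j _ => ?_
  rw [pderiv_comm j i p, pderiv_comm j i]

theorem pderiv_mem_sphericalHarmonics {m k : ℕ} {p : MvPolynomial (Fin m) ℂ}
    (hp : p ∈ sphericalHarmonics m k) (i : Fin m) :
    pderiv i p ∈ sphericalHarmonics m (k - 1) := by
  rw [mem_sphericalHarmonics] at hp ⊢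
  exact ⟨hp.1.pderiv, by rw [polyLaplacian_pderiv, hp.2, map_zero]⟩

/-- A linear functional on polynomials which is normalised and satisfies the integration by parts
formula of the standard Gaussian measure. -/
structure IsGaussianFunctional {m : ℕ} (I : MvPolynomial (Fin m) ℂ →ₗ[ℂ] ℂ) : Prop where
  one : I 1 = 1
  X_mul : ∀ i p, I (X i * p) = I (pderiv i p)

namespace IsGaussianFunctional

variable {m : ℕ} {I : MvPolynomial (Fin m) ℂ →ₗ[ℂ] ℂ}

theorem map_C_mul (I : MvPolynomial (Fin m) ℂ →ₗ[ℂ] ℂ) (c : ℂ) (p : MvPolynomial (Fin m) ℂ) :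
    I (C c * p) = c * I p := by
  rw [← smul_eq_C_mul, map_smul, smul_eq_mul]

theorem map_natCast_mul (I : MvPolynomial (Fin m) ℂ →ₗ[ℂ] ℂ) (c : ℕ)
    (p : MvPolynomial (Fin m) ℂ) : I ((c : MvPolynomial (Fin m) ℂ) * p) = c * I p := by
  rw [← map_natCast (C : ℂ →+* MvPolynomial (Fin m) ℂ), map_C_mul]

/-- Read backwards, integration by parts gives I(∂_i ∂_i p) = I(x_i ∂_i p); summing over i leaves
Euler's identity. -/
theorem laplacian (hI : IsGaussianFunctional I) {d : ℕ} {p : MvPolynomial (Fin m) ℂ}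
    (hp : p.IsHomogeneous d) : I (polyLaplacian m p) = d * I p := by
  rw [← map_natCast_mul, ← sum_X_mul_pderiv' hp, polyLaplacian_apply, map_sum, map_sum]
  exact Finset.sum_congr rfl fun i _ => (hI.X_mul i _).symm

theorem sqNorm_mul (hI : IsGaussianFunctional I) {d : ℕ} {p : MvPolynomial (Fin m) ℂ}
    (hp : p.IsHomogeneous d) : I (sqNorm m * p) = (d + m) * I p := by
  have h : ∀ i : Fin m, I (X i ^ 2 * p) = I p + I (X i * pderiv i p) := fun i => by
    rw [pow_two, mul_assoc, hI.X_mul, pderiv_mul, pderiv_X_self, one_mul, map_add]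
  rw [sqNorm, Finset.sum_mul, map_sum, Finset.sum_congr rfl fun i _ => h i,
    Finset.sum_add_distrib, ← map_sum I (fun i => X i * pderiv i p), sum_X_mul_pderiv' hp,
    map_natCast_mul]
  simp
  ring

theorem sqNorm_pow_mul (hI : IsGaussianFunctional I) {d : ℕ} {p : MvPolynomial (Fin m) ℂ}
    (hp : p.IsHomogeneous d) (n : ℕ) :
    I (sqNorm m ^ n * p) = (∏ i ∈ Finset.range n, ((d : ℂ) + m + 2 * i)) * I p := by
  induction n with
  | zero => simp
  | succ n ih =>
    rw [pow_succ', mul_assoc, hI.sqNorm_mul (isHomogeneous_sqNorm_pow_mul n hp), ih,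
      Finset.prod_range_succ]
    push_cast
    ring

/-- This is `laplacian` for the product pH of degree d + k, with Δ(pH) expanded and ΔH = 0. It
drives both inductions below. -/
theorem mul_harmonic (hI : IsGaussianFunctional I) {d k : ℕ} {p H : MvPolynomial (Fin m) ℂ}
    (hp : p.IsHomogeneous d) (hH : H ∈ sphericalHarmonics m k) :
    ((d : ℂ) + k) * I (p * H)
      = I (polyLaplacian m p * H) + 2 * ∑ i, I (pderiv i p * pderiv i H) := by
  have h := mem_sphericalHarmonics.1 hH
  have e := hI.laplacian (hp.mul h.1)
  rw [polyLaplacian_mul, h.2, mul_zero, add_zero, map_add] at e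
  rw [← map_sum]
  push_cast at e
  rw [← e, ← map_ofNat (C : ℂ →+* MvPolynomial (Fin m) ℂ), map_C_mul]

/-- Strong induction on d: the right side of `mul_harmonic` involves the degree pairs (d-2, k) and
(d-1, k-1), which still satisfy the strict inequality, and d + k ≠ 0 can be cancelled. -/
theorem mul_harmonic_eq_zero (hI : IsGaussianFunctional I) {d k : ℕ} (hdk : d < k)
    {p H : MvPolynomial (Fin m) ℂ} (hp : p.IsHomogeneous d)
    (hH : H ∈ sphericalHarmonics m k) : I (p * H) = 0 := by
  induction d using Nat.strong_induction_on generalizing k p H with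
  | _ d ih =>
    have e := hI.mul_harmonic hp hH
    have h0 : ((d : ℂ) + k) ≠ 0 := by
      have : d + k ≠ 0 := by omega
      exact_mod_cast this
    have hR : I (polyLaplacian m p * H) + 2 * ∑ i, I (pderiv i p * pderiv i H) = 0 := by
      rcases Nat.eq_zero_or_pos d with rfl | hd
      · simp [polyLaplacian_apply, pderiv_eq_zero_of_isHomogeneous_zero hp]
      · have h1 : ∀ i, I (pderiv i p * pderiv i H) = 0 := fun i =>
          ih (d - 1) (by omega) (by omega) hp.pderiv (pderiv_mem_sphericalHarmonics hH i)
        have h2 : I (polyLaplacian m p * H) = 0 :=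
          ih (d - 1 - 1) (by omega) (by omega) (by
            rw [polyLaplacian_apply]
            exact IsHomogeneous.sum _ _ _ fun i _ => hp.pderiv.pderiv) hH
        simp [h1, h2]
    rw [hR] at e
    exact (mul_eq_zero.1 e).resolve_left h0

/-- The reproducing property. In `mul_harmonic` the Laplacian of the power has lower degree and is
killed by orthogonality; the gradient term reduces to the harmonic polynomials ∂_i H of degree one
less, and Euler's identity at y reassembles H(y). -/
theorem linForm_pow_mul (hI : IsGaussianFunctional I) (y : Fin m → ℂ) {k : ℕ}
    {H : MvPolynomial (Fin m) ℂ} (hH : H ∈ sphericalHarmonics m k) :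
    I (linForm y ^ k * H) = (k ! : ℂ) * eval y H := by
  induction k generalizing H with
  | zero =>
    have h := (mem_sphericalHarmonics.1 hH).1
    rw [totalDegree_eq_zero_iff_eq_C.1 ((totalDegree_zero_iff_isHomogeneous _).2 h)]
    rw [pow_zero, one_mul, ← mul_one (C _), map_C_mul, hI.one]
    simp
  | succ k ih =>
    have hp : (linForm y ^ (k + 1)).IsHomogeneous (k + 1) := by
      simpa using (isHomogeneous_linForm y).pow (k + 1)
    have e := hI.mul_harmonic hp hH
    have h1 : I (polyLaplacian m (linForm y ^ (k + 1)) * H) = 0 := by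
      rw [polyLaplacian_linForm_pow, mul_assoc, map_C_mul, hI.mul_harmonic_eq_zero (d := k + 1 - 2)
        (by omega) (by simpa using (isHomogeneous_linForm y).pow (k + 1 - 2)) hH, mul_zero]
    have h2 : ∀ i, I (pderiv i (linForm y ^ (k + 1)) * pderiv i H)
        = (k + 1) * (k ! : ℂ) * (y i * eval y (pderiv i H)) := fun i => by
      have := ih (pderiv_mem_sphericalHarmonics hH i)
      rw [pderiv_pow, pderiv_linForm, mul_comm _ (C (y i)), mul_assoc, map_C_mul, mul_assoc,
        map_natCast_mul, Nat.add_sub_cancel, this]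
      push_cast
      ring
    have h3 : ∑ i, y i * eval y (pderiv i H) = (k + 1) * eval y H := by
      have := congrArg (eval y) (sum_X_mul_pderiv' (mem_sphericalHarmonics.1 hH).1)
      simpa using this
    rw [h1, zero_add, Finset.sum_congr rfl fun i _ => h2 i, ← Finset.mul_sum, h3] at e
    have h0 : ((k : ℂ) + 1) ≠ 0 := by exact_mod_cast k.succ_ne_zero
    have h4 : (2 * ((k : ℂ) + 1)) * I (linForm y ^ (k + 1) * H)
        = (2 * ((k : ℂ) + 1)) * (((k : ℂ) + 1) * (k ! : ℂ) * eval y H) := by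
      push_cast at e
      linear_combination e
    rw [mul_left_cancel₀ (mul_ne_zero two_ne_zero h0) h4, Nat.factorial_succ]
    push_cast
    ring

end IsGaussianFunctional

/-! ## Zonal polynomials -/

/-- The polynomial `∑_j c_j |y|^{2j} |x|^{2j} ⟨x,y⟩^{k-2j}` in `x`. -/
def zonal {m : ℕ} (k : ℕ) (c : ℕ → ℂ) (y : Fin m → ℂ) : MvPolynomial (Fin m) ℂ :=
  ∑ j ∈ Finset.range (k / 2 + 1),
    C (c j * (∑ i, y i ^ 2) ^ j) * (sqNorm m ^ j * linForm y ^ (k - 2 * j))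

theorem isHomogeneous_zonal {m : ℕ} (k : ℕ) (c : ℕ → ℂ) (y : Fin m → ℂ) :
    (zonal k c y).IsHomogeneous k :=
  IsHomogeneous.sum _ _ _ fun j hj => by
    have h := (isHomogeneous_C (Fin m) (c j * (∑ i, y i ^ 2) ^ j)).mul
      (isHomogeneous_sqNorm_pow_mul j ((isHomogeneous_linForm y).pow (k - 2 * j)))
    have hj' := Finset.mem_range.1 hj
    convert h using 1
    omega

/-- The Laplacian of the j-th summand has a part `u j`, from |x|^{2j}, and a part `v j`, from the
power of ⟨x,y⟩. The recursion `hc` says exactly that `u (j + 1)` cancels `v j`. -/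
theorem zonal_mem_sphericalHarmonics {m : ℕ} (k : ℕ) (c : ℕ → ℂ) (y : Fin m → ℂ)
    (hc : ∀ j, 2 * (j + 1) ≤ k →
      c (j + 1) * (2 * (j + 1) * (2 * k - 2 * j - 4 + m)) + c j * ((k - 2 * j) * (k - 2 * j - 1))
        = 0) :
    zonal k c y ∈ sphericalHarmonics m k := by
  refine mem_sphericalHarmonics.2 ⟨isHomogeneous_zonal k c y, ?_⟩
  set s : ℂ := ∑ i, y i ^ 2 with hs
  let u : ℕ → MvPolynomial (Fin m) ℂ := fun j =>
    C (c j * s ^ j * (2 * j * (2 * k - 2 * j - 2 + m))) *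
      (sqNorm m ^ (j - 1) * linForm y ^ (k - 2 * j))
  let v : ℕ → MvPolynomial (Fin m) ℂ := fun j =>
    C (c j * s ^ (j + 1) * ((k - 2 * j : ℕ) * (k - 2 * j - 1 : ℕ))) *
      (sqNorm m ^ j * linForm y ^ (k - 2 * j - 2))
  have h1 : polyLaplacian m (zonal k c y) = ∑ j ∈ Finset.range (k / 2 + 1), (u j + v j) := by
    rw [zonal, map_sum]
    refine Finset.sum_congr rfl fun j hj => ?_
    have hj' : 2 * j ≤ k := by have := Finset.mem_range.1 hj; omega
    rw [← smul_eq_C_mul, map_smul, smul_eq_C_mul]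
    rcases j with _ | j
    · simp only [pow_zero, one_mul, u, v, polyLaplacian_linForm_pow]
      simp only [Nat.cast_zero, mul_zero, zero_mul, map_zero, zero_add, ← hs,
        map_mul, map_one, pow_one, Nat.sub_zero]
      ring
    · have hl : (linForm y ^ (k - 2 * (j + 1))).IsHomogeneous (k - 2 * (j + 1)) := by
        simpa using (isHomogeneous_linForm y).pow (k - 2 * (j + 1))
      rw [polyLaplacian_sqNorm_pow_mul j hl, polyLaplacian_linForm_pow,
        ← map_natCast (C : ℂ →+* MvPolynomial (Fin m) ℂ)]
      have e : ((2 * (j + 1) * (2 * j + 2 * (k - 2 * (j + 1)) + m) : ℕ) : ℂ)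
          = 2 * ((j + 1 : ℕ) : ℂ) * (2 * k - 2 * ((j + 1 : ℕ) : ℂ) - 2 + m) := by
        push_cast [Nat.cast_sub hj']
        ring
      rw [e]
      simp only [u, v, Nat.add_sub_cancel, hs, map_mul, pow_succ]
      ring
  rw [h1, Finset.sum_add_distrib, Finset.sum_range_succ', Finset.sum_range_succ v]
  -- In the last summand the exponent of ⟨x,y⟩ is 0 or 1, so its second derivatives vanish.
  have hv : v (k / 2) = 0 := by
    have : (k - 2 * (k / 2)) * (k - 2 * (k / 2) - 1) = 0 := by
      rcases Nat.even_or_odd' k with ⟨r, rfl | rfl⟩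
      · simp
      · have : (2 * r + 1) / 2 = r := by omega
        simp [this]
    have h' : (((k - 2 * (k / 2) : ℕ) : ℂ) * ((k - 2 * (k / 2) - 1 : ℕ) : ℂ)) = 0 := by
      exact_mod_cast this
    simp only [v, h']
    simp
  have hu : u 0 = 0 := by simp [u]
  rw [hv, hu, add_zero, add_zero, ← Finset.sum_add_distrib]
  refine Finset.sum_eq_zero fun j hj => ?_
  have hj' : 2 * (j + 1) ≤ k := by have := Finset.mem_range.1 hj; omega
  have h := hc j hj'
  have e1 : ((k - 2 * j : ℕ) : ℂ) = k - 2 * j := by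
    rw [Nat.cast_sub (by omega)]
    push_cast
    ring
  have e2 : ((k - 2 * j - 1 : ℕ) : ℂ) = k - 2 * j - 1 := by
    rw [Nat.cast_sub (by omega), e1]
    push_cast
    ring
  have e3 : k - 2 * (j + 1) = k - 2 * j - 2 := by omega
  simp only [u, v, e1, e2, e3, Nat.add_sub_cancel]
  rw [← add_mul, ← map_add]
  have : c (j + 1) * s ^ (j + 1) * (2 * ((j + 1 : ℕ) : ℂ) * (2 * k - 2 * ((j + 1 : ℕ) : ℂ) - 2 + m))
      + c j * s ^ (j + 1) * ((k - 2 * j) * (k - 2 * j - 1)) = 0 := by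
    push_cast
    linear_combination s ^ (j + 1) * h
  rw [this, map_zero, zero_mul]

/-- For j > 0 the factor |x|^{2j} only contributes a scalar, and ⟨x,y⟩^{k-2j} has degree below k,
hence is orthogonal to H. The j = 0 term is `linForm_pow_mul`. -/
theorem IsGaussianFunctional.zonal_mul {m : ℕ} {I : MvPolynomial (Fin m) ℂ →ₗ[ℂ] ℂ}
    (hI : IsGaussianFunctional I) (k : ℕ) (c : ℕ → ℂ) (y : Fin m → ℂ)
    {H : MvPolynomial (Fin m) ℂ} (hH : H ∈ sphericalHarmonics m k) :
    I (zonal k c y * H) = c 0 * (k ! : ℂ) * eval y H := by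
  rw [zonal, Finset.sum_mul, map_sum, Finset.sum_eq_single 0]
  · simp only [pow_zero, mul_one, one_mul, mul_zero, Nat.sub_zero]
    rw [mul_assoc, IsGaussianFunctional.map_C_mul, hI.linForm_pow_mul y hH]
    ring
  · intro j hj hj0
    have hj' := Finset.mem_range.1 hj
    have h := (mem_sphericalHarmonics.1 hH).1
    have hl : (linForm y ^ (k - 2 * j)).IsHomogeneous (k - 2 * j) := by
      simpa using (isHomogeneous_linForm y).pow (k - 2 * j)
    rw [mul_assoc, IsGaussianFunctional.map_C_mul, mul_assoc (_ ^ j), hI.sqNorm_pow_mul (hl.mul h),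
      hI.mul_harmonic_eq_zero (by omega) hl hH]
    simp
  · simp

theorem IsGaussianFunctional.harmonic_mul_harmonic {m : ℕ} {I : MvPolynomial (Fin m) ℂ →ₗ[ℂ] ℂ}
    (hI : IsGaussianFunctional I) {k l : ℕ} (hkl : k ≠ l) {P H : MvPolynomial (Fin m) ℂ}
    (hP : P ∈ sphericalHarmonics m k) (hH : H ∈ sphericalHarmonics m l) :
    I (P * H) = 0 := by
  rcases lt_or_gt_of_ne hkl with h | h
  · exact hI.mul_harmonic_eq_zero h (mem_sphericalHarmonics.1 hP).1 hH
  · rw [mul_comm]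
    exact hI.mul_harmonic_eq_zero h (mem_sphericalHarmonics.1 hH).1 hP

/-! ## Polynomials times the Gaussian -/

/-- The evaluation of a complex polynomial at a point of `ℝ^m`. -/
def evalAt {m : ℕ} (x : E m) : MvPolynomial (Fin m) ℂ →+* ℂ :=
  eval (fun i => (x i : ℂ))

@[simp]
theorem evalAt_X {m : ℕ} (x : E m) (i : Fin m) : evalAt x (X i) = (x i : ℂ) := eval_X i

@[simp]
theorem evalAt_C {m : ℕ} (x : E m) (c : ℂ) : evalAt x (C c) = c := eval_C c

theorem smulLeft_evalAt_apply {m : ℕ} (p : MvPolynomial (Fin m) ℂ) (x : E m) :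
    SchwartzMap.smulLeftCLM ℂ (fun x : E m => evalAt x p)
      (SchwartzMap.postcompCLM (𝕜 := ℝ) Complex.ofRealCLM (gaussian m)) x
      = evalAt x p * (Real.exp (-‖x‖ ^ 2 / 2) : ℂ) :=
  SchwartzMap.smulLeftCLM_apply_apply (temperate_eval m p) _ x

/-- The Schwartz function `p(x) exp(-|x|²/2)`. -/
def polyGaussian (m : ℕ) : MvPolynomial (Fin m) ℂ →ₗ[ℂ] 𝓢(E m, ℂ) where
  toFun p := SchwartzMap.smulLeftCLM ℂ (fun x : E m => evalAt x p)
    (SchwartzMap.postcompCLM (𝕜 := ℝ) Complex.ofRealCLM (gaussian m))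
  map_add' p q := by
    ext x
    rw [add_apply, smulLeft_evalAt_apply, smulLeft_evalAt_apply, smulLeft_evalAt_apply, map_add,
      add_mul]
  map_smul' c p := by
    ext x
    rw [smul_apply, smulLeft_evalAt_apply, smulLeft_evalAt_apply, smul_eq_C_mul, map_mul, evalAt_C,
      mul_assoc, RingHom.id_apply, smul_eq_mul]

theorem polyGaussian_apply {m : ℕ} (p : MvPolynomial (Fin m) ℂ) (x : E m) :
    polyGaussian m p x = evalAt x p * (Real.exp (-‖x‖ ^ 2 / 2) : ℂ) :=
  smulLeft_evalAt_apply p x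

/-- The `i`-th coordinate as a real linear map to `ℂ`. -/
def coordCLM {m : ℕ} (i : Fin m) : E m →L[ℝ] ℂ :=
  Complex.ofRealCLM.comp (EuclideanSpace.proj (𝕜 := ℝ) i)

theorem coordCLM_apply {m : ℕ} (i : Fin m) (x : E m) : coordCLM i x = (x i : ℂ) := rfl

theorem hasFDerivAt_evalAt {m : ℕ} (p : MvPolynomial (Fin m) ℂ) (x : E m) :
    HasFDerivAt (fun x : E m => evalAt x p) (∑ i, evalAt x (pderiv i p) • coordCLM i) x := by
  induction p using MvPolynomial.induction_on with
  | C a =>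
    simp only [evalAt_C]
    refine (hasFDerivAt_const a x).congr_fderiv ?_
    ext v
    simp
  | add p q hp hq =>
    have e : (fun x : E m => evalAt x (p + q))
        = (fun x : E m => evalAt x p) + fun x => evalAt x q := by
      funext x
      simp
    rw [e]
    refine (hp.add hq).congr_fderiv ?_
    ext v
    simp [add_mul, Finset.sum_add_distrib]
  | mul_X p j hp =>
    have h := hp.mul (coordCLM j).hasFDerivAt
    have e : (fun x : E m => evalAt x (p * X j)) = (fun x : E m => evalAt x p) * coordCLM j := by
      funext x
      simp [coordCLM_apply]
    rw [e]
    refine h.congr_fderiv ?_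
    classical
    ext v
    simp [coordCLM_apply, pderiv_X, Pi.single_apply, Finset.sum_add_distrib, add_mul,
      Finset.mul_sum, apply_ite, mul_assoc]

theorem hasFDerivAt_gaussian {m : ℕ} (x : E m) :
    HasFDerivAt (fun x : E m => (Real.exp (-‖x‖ ^ 2 / 2) : ℂ))
      (-(Real.exp (-‖x‖ ^ 2 / 2) : ℂ) • ∑ i, (x i : ℂ) • coordCLM i) x := by
  have h1 : HasFDerivAt (fun x : E m => -‖x‖ ^ 2 / 2) (-innerSL ℝ x) x := by
    have := ((hasStrictFDerivAt_norm_sq x).hasFDerivAt.neg).mul_const (2⁻¹ : ℝ)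
    simp only [div_eq_mul_inv]
    refine this.congr_fderiv ?_
    ext v
    simp
  have h2 := Complex.ofRealCLM.hasFDerivAt.comp x h1.exp
  refine h2.congr_fderiv ?_
  ext v
  simp [coordCLM_apply, PiLp.inner_apply]
  exact Finset.sum_congr rfl fun i _ => mul_comm _ _

theorem lineDeriv_polyGaussian {m : ℕ} (i : Fin m) (p : MvPolynomial (Fin m) ℂ) :
    ∂_{EuclideanSpace.basisFun (Fin m) ℝ i} (polyGaussian m p)
      = polyGaussian m (pderiv i p - X i * p) := by
  ext x
  rw [SchwartzMap.lineDerivOp_apply_eq_fderiv]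
  have h := (hasFDerivAt_evalAt p x).mul (hasFDerivAt_gaussian x)
  have e : (polyGaussian m p : E m → ℂ)
      = (fun x => evalAt x p) * fun x => (Real.exp (-‖x‖ ^ 2 / 2) : ℂ) :=
    funext fun x => polyGaussian_apply p x
  classical
  rw [e, h.fderiv, polyGaussian_apply]
  simp [coordCLM_apply, apply_ite]
  ring

/-- On the polynomial factor, ∂_i acts as ∂_i - x_i; the formula is the sum of the squares of these
operators. -/
theorem laplacian_polyGaussian {m : ℕ} (p : MvPolynomial (Fin m) ℂ) :
    Δ (polyGaussian m p) = polyGaussian m (polyLaplacian m p - 2 * ∑ i, X i * pderiv i p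
      - (m : MvPolynomial (Fin m) ℂ) * p + sqNorm m * p) := by
  rw [SchwartzMap.laplacian_eq_sum (EuclideanSpace.basisFun (Fin m) ℝ)]
  simp only [lineDeriv_polyGaussian]
  rw [← map_sum]
  congr 1
  have hm : (m : MvPolynomial (Fin m) ℂ) * p = ∑ i : Fin m, p := by simp
  rw [hm, polyLaplacian_apply, sqNorm, Finset.mul_sum, Finset.sum_mul, ← Finset.sum_sub_distrib,
    ← Finset.sum_sub_distrib, ← Finset.sum_add_distrib]
  refine Finset.sum_congr rfl fun i _ => ?_
  rw [map_sub, pderiv_mul, pderiv_X_self]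
  ring

theorem evalAt_sqNorm {m : ℕ} (x : E m) : evalAt x (sqNorm m) = ((‖x‖ ^ 2 : ℝ) : ℂ) := by
  simp [sqNorm, EuclideanSpace.norm_sq_eq]

theorem normSqMul_polyGaussian {m : ℕ} (p : MvPolynomial (Fin m) ℂ) :
    normSqMul m (polyGaussian m p) = polyGaussian m (sqNorm m * p) := by
  ext x
  rw [normSqMul_apply, polyGaussian_apply, polyGaussian_apply, map_mul,
    ← evalAt_sqNorm]
  ring

/-- Integration against the standard Gaussian measure. -/
def gaussianIntegral (m : ℕ) : MvPolynomial (Fin m) ℂ →ₗ[ℂ] ℂ where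
  toFun p := (1 / ((2 * Real.pi) ^ ((m : ℝ) / 2) : ℝ) : ℂ) * ∫ x, polyGaussian m p x
  map_add' p q := by
    have := integral_add (polyGaussian m p).integrable (polyGaussian m q).integrable
      (μ := (volume : Measure (E m)))
    simp only [map_add, add_apply]
    rw [this, mul_add]
  map_smul' c p := by
    simp only [map_smul, smul_apply, smul_eq_mul, RingHom.id_apply]
    rw [integral_const_mul]
    ring

theorem gaussianIntegral_apply {m : ℕ} (p : MvPolynomial (Fin m) ℂ) :
    gaussianIntegral m p
      = (1 / ((2 * Real.pi) ^ ((m : ℝ) / 2) : ℝ) : ℂ) * ∫ x, polyGaussian m p x := rfl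

theorem integral_lineDeriv {m : ℕ} (f : 𝓢(E m, ℂ)) (v : E m) : ∫ x, ∂_{v} f x = 0 := by
  simp only [SchwartzMap.lineDerivOp_apply_eq_fderiv]
  have h1 : Integrable (fun x => fderiv ℝ f x v) := by
    have := (∂_{v} f : 𝓢(E m, ℂ)).integrable (μ := (volume : Measure (E m)))
    exact this.congr (Filter.Eventually.of_forall fun x =>
      SchwartzMap.lineDerivOp_apply_eq_fderiv v f x)
  have h := integral_mul_fderiv_eq_neg_fderiv_mul_of_integrable (μ := (volume : Measure (E m)))
    (f := fun _ : E m => (1 : ℂ)) (g := f) (v := v) (by simp) (by simpa using h1)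
    (by simpa using f.integrable) (by fun_prop) (fun x _ => f.differentiableAt)
  simpa using h

/-- The integration by parts rule holds because the integral of ∂_i(p e^{-|x|²/2}) = (∂_i p - x_i p)
e^{-|x|²/2} vanishes. -/
theorem isGaussianFunctional_gaussianIntegral (m : ℕ) :
    IsGaussianFunctional (gaussianIntegral m) where
  one := by
    have h := GaussianFourier.integral_rexp_neg_mul_sq_norm (V := E m) (b := 1 / 2) (by norm_num)
    have e : ∀ x : E m, polyGaussian m 1 x = ((Real.exp (-(1 / 2) * ‖x‖ ^ 2) : ℝ) : ℂ) := fun x => by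
      rw [polyGaussian_apply, map_one, one_mul]
      congr 2
      ring
    simp only [gaussianIntegral_apply, e]
    rw [integral_complex_ofReal, h]
    have h2 : Real.pi / (1 / 2) = 2 * Real.pi := by ring
    have h3 : (0 : ℝ) < (2 * Real.pi) ^ ((m : ℝ) / 2) := by positivity
    rw [h2, finrank_euclideanSpace_fin, ← Complex.ofReal_one, ← Complex.ofReal_div,
      ← Complex.ofReal_mul, one_div_mul_cancel h3.ne']
  X_mul i p := by
    have h := integral_lineDeriv (polyGaussian m p) (EuclideanSpace.basisFun (Fin m) ℝ i)
    rw [lineDeriv_polyGaussian] at h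
    have e : gaussianIntegral m (pderiv i p - X i * p) = 0 := by
      rw [gaussianIntegral_apply, h, mul_zero]
    rw [map_sub, sub_eq_zero] at e
    exact e.symm

/-! ## The action on radial multiples of a harmonic polynomial -/

/-- A form of Chu–Vandermonde, by induction on n. Pascal's rule splits the sum for n + 1 into the
sum for n at (l, β) and l times the sum for n at (l - 1, β + 1). -/
theorem gamma_vandermonde (n l : ℕ) {β : ℝ} (hβ : 0 < β) :
    ∑ i ∈ Finset.range (n + 1), (n.choose i : ℝ) * (l.descFactorial i) / Real.Gamma (β + i)
      = Real.Gamma (l + n + β) / (Real.Gamma (l + β) * Real.Gamma (β + n)) := by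
  induction n generalizing l β with
  | zero =>
    have h1 : Real.Gamma (l + β) ≠ 0 := (Real.Gamma_pos_of_pos (by positivity)).ne'
    simp
    field_simp
  | succ n ih =>
    have hG1 : Real.Gamma (l + β) ≠ 0 := (Real.Gamma_pos_of_pos (by positivity)).ne'
    have hG2 : Real.Gamma (β + n) ≠ 0 := (Real.Gamma_pos_of_pos (by positivity)).ne'
    have e1 : Real.Gamma (l + (n + 1 : ℕ) + β) = (l + n + β) * Real.Gamma (l + n + β) := by
      rw [← Real.Gamma_add_one (by positivity)]
      push_cast
      ring_nf
    have e2 : Real.Gamma (β + (n + 1 : ℕ)) = (β + n) * Real.Gamma (β + n) := by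
      rw [← Real.Gamma_add_one (by positivity)]
      push_cast
      ring_nf
    have h0 : β + n ≠ 0 := by positivity
    have hsplit : ∑ i ∈ Finset.range (n + 1 + 1),
        ((n + 1).choose i : ℝ) * (l.descFactorial i) / Real.Gamma (β + i)
        = ∑ i ∈ Finset.range (n + 1), (n.choose i : ℝ) * (l.descFactorial i) / Real.Gamma (β + i)
        + ∑ i ∈ Finset.range (n + 1),
          (n.choose i : ℝ) * (l.descFactorial (i + 1)) / Real.Gamma (β + 1 + i) := by
      have h := Finset.sum_range_succ (fun i : ℕ => (n.choose (i + 1) : ℝ) *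
        (l.descFactorial (i + 1)) / Real.Gamma (β + (i + 1 : ℕ))) n
      simp only [Nat.choose_succ_self, Nat.cast_zero, zero_mul, zero_div, add_zero] at h
      rw [Finset.sum_range_succ' _ (n + 1), Finset.sum_range_succ' (fun i : ℕ =>
        (n.choose i : ℝ) * (l.descFactorial i) / Real.Gamma (β + i)) n, ← h]
      have h' : ∀ i : ℕ, ((n + 1).choose (i + 1) : ℝ) * (l.descFactorial (i + 1))
            / Real.Gamma (β + (i + 1 : ℕ))
          = (n.choose (i + 1) : ℝ) * (l.descFactorial (i + 1)) / Real.Gamma (β + (i + 1 : ℕ))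
          + (n.choose i : ℝ) * (l.descFactorial (i + 1)) / Real.Gamma (β + 1 + i) := fun i => by
        have : β + (i + 1 : ℕ) = β + 1 + i := by
          push_cast
          ring
        rw [Nat.choose_succ_succ, this]
        push_cast
        ring
      rw [Finset.sum_congr rfl fun i _ => h' i, Finset.sum_add_distrib]
      simp only [Nat.choose_zero_right]
      ring
    rw [hsplit, ih l hβ]
    rcases l with _ | l
    · simp only [Nat.zero_descFactorial_succ, Nat.cast_zero, mul_zero, zero_div,
        Finset.sum_const_zero, add_zero, zero_add] at *
      rw [e1, e2]
      have h1 : (n : ℝ) + β ≠ 0 := by positivity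
      rw [add_comm (n : ℝ) β] at *
      field_simp
    · have h1 : ∀ i : ℕ, (n.choose i : ℝ) * ((l + 1).descFactorial (i + 1)) / Real.Gamma (β + 1 + i)
          = (l + 1) * ((n.choose i : ℝ) * (l.descFactorial i) / Real.Gamma (β + 1 + i)) :=
        fun i => by
          rw [Nat.succ_descFactorial_succ]
          push_cast
          ring
      have e3 : (l : ℝ) + n + (β + 1) = (l + 1 : ℕ) + n + β := by
        push_cast
        ring
      have e4 : (l : ℝ) + (β + 1) = (l + 1 : ℕ) + β := by
        push_cast
        ring
      have e5 : β + 1 + n = β + (n + 1 : ℕ) := by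
        push_cast
        ring
      rw [Finset.sum_congr rfl fun i _ => h1 i, ← Finset.mul_sum, ih l (by positivity), e3, e4, e5,
        e1, e2]
      push_cast at *
      field_simp
      ring

theorem hasSum_descFactorial_mul_exp (i : ℕ) (x : ℝ) :
    HasSum (fun l : ℕ => (l.descFactorial i : ℝ) * (x ^ l / l !)) (x ^ i * Real.exp x) := by
  rw [← hasSum_nat_add_iff' i, Finset.sum_eq_zero, sub_zero]
  · have h : HasSum (fun n : ℕ => x ^ n / n !) (Real.exp x) := by
      rw [Real.exp_eq_exp_ℝ]
      exact NormedSpace.expSeries_div_hasSum_exp x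
    refine (h.mul_left (x ^ i)).congr_fun fun n => ?_
    have h1 : (n ! : ℝ) * ((n + i).descFactorial i) = ((n + i)! : ℝ) := by
      have := Nat.factorial_mul_descFactorial (Nat.le_add_left i n)
      rw [Nat.add_sub_cancel] at this
      exact_mod_cast this
    have h2 : (n ! : ℝ) ≠ 0 := by positivity
    have h3 : ((n + i)! : ℝ) ≠ 0 := by positivity
    field_simp
    rw [← h1]
    ring
  · intro l hl
    rw [Nat.descFactorial_eq_zero_iff_lt.2 (Finset.mem_range.1 hl)]
    simp

/-- The coefficients of the polynomial `q_n` with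
`(-Δ)^n (H e^{-|x|²/2}) = q_n(|x|²) H e^{-|x|²/2}`, where `β = m/2 + k`. -/
def radialCoeff (β : ℝ) (n i : ℕ) : ℝ :=
  2 ^ n * (n.choose i) * (Real.Gamma (β + n) / Real.Gamma (β + i)) * (-1 / 2) ^ i

/-- The left side is the series produced by integrating a kernel term. Vandermonde writes each Gamma
quotient as a combination of falling factorials of l, and these weight the exponential series to x^i
e^x. -/
theorem hasSum_radialCoeff {β : ℝ} (hβ : 0 < β) (n : ℕ) (s : ℝ) :
    HasSum (fun l : ℕ => 2 ^ n * (Real.Gamma (l + n + β) / Real.Gamma (l + β))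
        * ((-s / 2) ^ l / l !))
      ((∑ i ∈ Finset.range (n + 1), radialCoeff β n i * s ^ i) * Real.exp (-s / 2)) := by
  have h := hasSum_sum (s := Finset.range (n + 1)) fun i _ =>
    (hasSum_descFactorial_mul_exp i (-s / 2)).mul_left
      (2 ^ n * (n.choose i) * (Real.Gamma (β + n) / Real.Gamma (β + i)))
  rw [Finset.sum_mul]
  have hv : ∑ i ∈ Finset.range (n + 1), radialCoeff β n i * s ^ i * Real.exp (-s / 2)
      = ∑ i ∈ Finset.range (n + 1), 2 ^ n * (n.choose i) * (Real.Gamma (β + n)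
        / Real.Gamma (β + i)) * ((-s / 2) ^ i * Real.exp (-s / 2)) := by
    refine Finset.sum_congr rfl fun i _ => ?_
    have : (-s / 2) ^ i = (-1 / 2) ^ i * s ^ i := by
      rw [← mul_pow]
      congr 1
      ring
    rw [radialCoeff, this]
    ring
  rw [hv]
  refine h.congr_fun fun l => ?_
  have hG : Real.Gamma (β + n) ≠ 0 := (Real.Gamma_pos_of_pos (by positivity)).ne'
  have e' : Real.Gamma (l + n + β) / Real.Gamma (l + β) = Real.Gamma (β + n) *
      ∑ i ∈ Finset.range (n + 1), (n.choose i : ℝ) * (l.descFactorial i)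
        / Real.Gamma (β + i) := by
    rw [gamma_vandermonde n l hβ]
    field_simp
  rw [e', Finset.mul_sum, Finset.mul_sum, Finset.sum_mul]
  refine Finset.sum_congr rfl fun i _ => ?_
  ring

theorem radialCoeff_eq_zero (β : ℝ) {n i : ℕ} (h : n < i) : radialCoeff β n i = 0 := by
  simp [radialCoeff, Nat.choose_eq_zero_of_lt h]

theorem radialCoeff_succ_right {β : ℝ} (hβ : 0 < β) (n i : ℕ) :
    2 * (i + 1) * (β + i) * radialCoeff β n (i + 1) = (i - n) * radialCoeff β n i := by
  have hG : Real.Gamma (β + i) ≠ 0 := (Real.Gamma_pos_of_pos (by positivity)).ne'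
  have e2 : Real.Gamma (β + (i + 1 : ℕ)) = (β + i) * Real.Gamma (β + i) := by
    rw [← Real.Gamma_add_one (by positivity)]
    push_cast
    ring_nf
  have h0 : β + i ≠ 0 := by positivity
  have hc : (n.choose (i + 1) : ℝ) * (i + 1) = n.choose i * (n - i) := by
    rcases le_or_gt i n with h | h
    · rw [← Nat.cast_sub h]
      exact_mod_cast Nat.choose_succ_right_eq n i
    · simp [Nat.choose_eq_zero_of_lt h, Nat.choose_eq_zero_of_lt (h.trans (Nat.lt_succ_self i))]
  rw [radialCoeff, radialCoeff, e2, pow_succ]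
  field_simp
  linear_combination (-1 : ℝ) * hc

theorem radialCoeff_succ_left {β : ℝ} (hβ : 0 < β) (n i : ℕ) :
    (n + 1 - i) * radialCoeff β (n + 1) i = 2 * (n + 1) * (β + n) * radialCoeff β n i := by
  have e2 : Real.Gamma (β + (n + 1 : ℕ)) = (β + n) * Real.Gamma (β + n) := by
    rw [← Real.Gamma_add_one (by positivity)]
    push_cast
    ring_nf
  have hc : ((n + 1).choose i : ℝ) * (n + 1 - i) = (n + 1) * n.choose i := by
    rcases le_or_gt i (n + 1) with h | h
    · have := Nat.add_one_mul_choose_eq n i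
      rcases i with _ | i
      · simp
      · have h2 : ((n + 1 : ℕ) : ℝ) - ((i + 1 : ℕ) : ℝ) = ((n - i : ℕ) : ℝ) := by
          rw [Nat.cast_sub (by omega)]
          push_cast
          ring
        have h3 := Nat.choose_mul_succ_eq n (i + 1)
        rw [Nat.add_sub_add_right] at h3
        push_cast at h2 ⊢
        rw [h2]
        have h4 : ((n.choose (i + 1) * (n + 1) : ℕ) : ℝ)
            = (((n + 1).choose (i + 1) * (n - i) : ℕ) : ℝ) := by rw [h3]
        push_cast at h4
        linarith
    · simp [Nat.choose_eq_zero_of_lt h, Nat.choose_eq_zero_of_lt ((Nat.lt_succ_self n).trans h)]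
  rw [radialCoeff, radialCoeff, e2, pow_succ]
  linear_combination (2 : ℝ) ^ n * 2 * ((β + n) * Real.Gamma (β + n) / Real.Gamma (β + i))
    * (-1 / 2) ^ i * hc

theorem radialCoeff_zero_rec {β : ℝ} (hβ : 0 < β) (n : ℕ) :
    -(4 * β * radialCoeff β n 1) + 2 * β * radialCoeff β n 0 = radialCoeff β (n + 1) 0 := by
  have h1 := radialCoeff_succ_right hβ n 0
  have h2 := radialCoeff_succ_left hβ n 0
  simp only [Nat.cast_zero, zero_add, add_zero, sub_zero, zero_sub, mul_one] at h1 h2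
  have h0 : (n : ℝ) + 1 ≠ 0 := by positivity
  refine mul_left_cancel₀ h0 ?_
  rw [h2]
  linear_combination -(2 * ((n : ℝ) + 1)) * h1

/-- The left side is the coefficient of |x|^{2(i+1)} H e^{-|x|²/2} after -Δ acts on the n-th radial
multiple; it follows from the one-step relations in i and in n. -/
theorem radialCoeff_succ_rec {β : ℝ} (hβ : 0 < β) (n i : ℕ) :
    -(4 * (i + 2) * (i + 1 + β) * radialCoeff β n (i + 2))
      + (4 * (i + 1) + 2 * β) * radialCoeff β n (i + 1) - radialCoeff β n i
        = radialCoeff β (n + 1) (i + 1) := by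
  have h1 := radialCoeff_succ_right hβ n i
  have h2 := radialCoeff_succ_right hβ n (i + 1)
  have h3 := radialCoeff_succ_left hβ n (i + 1)
  push_cast at h2 h3
  -- The one-step relations prove the claim only after multiplication by n - i. For i = n the
  -- leading coefficients (-1)^n are compared directly.
  rcases eq_or_ne i n with rfl | hin
  · rw [radialCoeff_eq_zero β (show i < i + 2 by omega), radialCoeff_eq_zero β (Nat.lt_succ_self i)]
    have hG (j : ℕ) : Real.Gamma (β + j) ≠ 0 := (Real.Gamma_pos_of_pos (by positivity)).ne'
    have h4 (j : ℕ) : radialCoeff β j j = (-1) ^ j := by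
      rw [radialCoeff, Nat.choose_self, div_self (hG j), Nat.cast_one, mul_one, mul_one, ← mul_pow]
      norm_num
    rw [h4, h4, pow_succ]
    ring
  · have h0 : (n : ℝ) - i ≠ 0 := sub_ne_zero.2 (by exact_mod_cast hin.symm)
    refine mul_left_cancel₀ h0 ?_
    linear_combination -h1 - 2 * ((n : ℝ) - i) * h2 - h3

theorem laplacian_polyGaussian_sqNorm_pow {m k : ℕ} {H : MvPolynomial (Fin m) ℂ}
    (hH : H ∈ sphericalHarmonics m k) (n : ℕ) :
    Δ (polyGaussian m (sqNorm m ^ n * H)) =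
      (4 * n * (n - 1 + ((m : ℂ) / 2 + k))) • polyGaussian m (sqNorm m ^ (n - 1) * H)
      - (4 * n + 2 * ((m : ℂ) / 2 + k)) • polyGaussian m (sqNorm m ^ n * H)
      + polyGaussian m (sqNorm m ^ (n + 1) * H) := by
  obtain ⟨h1, h2⟩ := mem_sphericalHarmonics.1 hH
  rw [laplacian_polyGaussian, sum_X_mul_pderiv' (isHomogeneous_sqNorm_pow_mul n h1),
    ← map_smul, ← map_smul, ← map_sub, ← map_add]
  congr 1
  have hn : polyLaplacian m (sqNorm m ^ n * H) = (4 * n * (n - 1 + ((m : ℂ) / 2 + k))) •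
      (sqNorm m ^ (n - 1) * H) := by
    rcases n with _ | n
    · simp [h2]
    · rw [polyLaplacian_sqNorm_pow_mul n h1, h2, mul_zero, add_zero, Nat.add_sub_cancel,
        smul_eq_C_mul, ← map_natCast (C : ℂ →+* MvPolynomial (Fin m) ℂ)]
      congr 2
      push_cast
      ring
  have hc : (4 * n + 2 * ((m : ℂ) / 2 + k)) • (sqNorm m ^ n * H)
      = 2 * (((2 * n + k : ℕ) : MvPolynomial (Fin m) ℂ) * (sqNorm m ^ n * H))
        + (m : MvPolynomial (Fin m) ℂ) * (sqNorm m ^ n * H) := by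
    have e : (4 * n + 2 * ((m : ℂ) / 2 + k)) = ((2 * (2 * n + k) + m : ℕ) : ℂ) := by
      push_cast
      ring
    rw [smul_eq_C_mul, e, map_natCast]
    push_cast
    ring
  rw [hn, hc]
  ring

/-- The polynomial `q_n(|x|²) H(x)`. -/
def radialMul {m : ℕ} (β : ℝ) (n : ℕ) (H : MvPolynomial (Fin m) ℂ) : MvPolynomial (Fin m) ℂ :=
  ∑ i ∈ Finset.range (n + 1), (radialCoeff β n i : ℂ) • (sqNorm m ^ i * H)

theorem evalAt_radialMul {m : ℕ} (β : ℝ) (n : ℕ) (H : MvPolynomial (Fin m) ℂ) (x : E m) :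
    evalAt x (radialMul β n H)
      = ((∑ i ∈ Finset.range (n + 1), radialCoeff β n i * (‖x‖ ^ 2) ^ i : ℝ) : ℂ)
        * evalAt x H := by
  rw [radialMul, map_sum]
  push_cast
  rw [Finset.sum_mul]
  refine Finset.sum_congr rfl fun i _ => ?_
  rw [smul_eq_C_mul, map_mul, map_mul, map_pow, evalAt_C, evalAt_sqNorm]
  push_cast
  ring

theorem laplacian_smul' {m : ℕ} (c : ℂ) (f : 𝓢(E m, ℂ)) : Δ (c • f) = c • Δ f := by
  rw [← SchwartzMap.laplacianCLM_eq (𝕜 := ℂ), map_smul, SchwartzMap.laplacianCLM_eq]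

theorem laplacian_sum' {m : ℕ} {ι : Type*} (s : Finset ι) (f : ι → 𝓢(E m, ℂ)) :
    Δ (∑ i ∈ s, f i) = ∑ i ∈ s, Δ (f i) := by
  rw [← SchwartzMap.laplacianCLM_eq (𝕜 := ℂ), map_sum]
  simp only [SchwartzMap.laplacianCLM_eq]

theorem laplacian_radialMul {m k : ℕ} (hm : 1 ≤ m) {H : MvPolynomial (Fin m) ℂ}
    (hH : H ∈ sphericalHarmonics m k) (n : ℕ) :
    Δ (polyGaussian m (radialMul ((m : ℝ) / 2 + k) n H))
      = -polyGaussian m (radialMul ((m : ℝ) / 2 + k) (n + 1) H) := by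
  have hm' : (0 : ℝ) < m := by exact_mod_cast hm
  set β : ℝ := (m : ℝ) / 2 + k with hβ
  have hβ0 : 0 < β := by positivity
  have hβ' : (m : ℂ) / 2 + k = (β : ℂ) := by rw [hβ]; push_cast; rfl
  have hz : radialCoeff β n (n + 1) = 0 := radialCoeff_eq_zero β (Nat.lt_succ_self n)
  have hz2 : radialCoeff β n (n + 2) = 0 := radialCoeff_eq_zero β (by omega)
  set r : ℕ → 𝓢(E m, ℂ) := fun i => polyGaussian m (sqNorm m ^ i * H) with hr
  have hrad (n : ℕ) : polyGaussian m (radialMul β n H)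
      = ∑ i ∈ Finset.range (n + 1), (radialCoeff β n i : ℂ) • r i := by
    rw [radialMul, map_sum]
    simp only [map_smul, hr]
  have hL (i : ℕ) : Δ ((radialCoeff β n i : ℂ) • r i)
      = (4 * i * (i - 1 + β) * radialCoeff β n i : ℂ) • r (i - 1)
        - ((4 * i + 2 * β) * radialCoeff β n i : ℂ) • r i + (radialCoeff β n i : ℂ) • r (i + 1) := by
    rw [laplacian_smul', hr, laplacian_polyGaussian_sqNorm_pow hH, hβ']
    module
  have s1 : ∑ i ∈ Finset.range (n + 1), (4 * i * (i - 1 + β) * radialCoeff β n i : ℂ) • r (i - 1)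
      = ∑ i ∈ Finset.range (n + 2),
        (4 * (i + 1) * (i + β) * radialCoeff β n (i + 1) : ℂ) • r i := by
    rw [Finset.sum_range_succ', Finset.sum_range_succ, Finset.sum_range_succ, hz, hz2]
    simp only [Nat.add_sub_cancel]
    push_cast
    simp
  have s2 : ∑ i ∈ Finset.range (n + 1), ((4 * i + 2 * β) * radialCoeff β n i : ℂ) • r i
      = ∑ i ∈ Finset.range (n + 2), ((4 * i + 2 * β) * radialCoeff β n i : ℂ) • r i := by
    rw [Finset.sum_range_succ _ (n + 1), hz]
    simp
  rw [hrad, hrad, laplacian_sum', Finset.sum_congr rfl fun i _ => hL i, Finset.sum_add_distrib,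
    Finset.sum_sub_distrib, s1, s2, ← Finset.sum_sub_distrib, Finset.sum_range_succ',
    Finset.sum_range_succ' _ (n + 1), add_right_comm, ← Finset.sum_add_distrib, neg_add,
    ← Finset.sum_neg_distrib]
  congr 1
  · refine Finset.sum_congr rfl fun i _ => ?_
    rw [← radialCoeff_succ_rec hβ0]
    push_cast
    module
  · rw [← radialCoeff_zero_rec hβ0]
    push_cast
    module

/-- Each factor |x|² passes through T as -Δ, which raises the index of the radial polynomial by one.
Hence the eigenvalue on H e^{-|x|²/2} alone fixes T on all radial multiples. -/
theorem map_polyGaussian_sqNorm_pow {m k : ℕ} (hm : 1 ≤ m) {T : 𝓢(E m, ℂ) →ₗ[ℂ] 𝓢(E m, ℂ)}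
    (hT : HelmholtzRelations T) {H : MvPolynomial (Fin m) ℂ} (hH : H ∈ sphericalHarmonics m k)
    {c : ℂ} (hc : T (polyGaussian m H) = c • polyGaussian m H) (n : ℕ) :
    T (polyGaussian m (sqNorm m ^ n * H))
      = c • polyGaussian m (radialMul ((m : ℝ) / 2 + k) n H) := by
  induction n with
  | zero =>
    have hm' : (0 : ℝ) < m := by exact_mod_cast hm
    have hG : Real.Gamma ((m : ℝ) / 2 + k) ≠ 0 := (Real.Gamma_pos_of_pos (by positivity)).ne'
    simpa [radialMul, radialCoeff, hG] using hc
  | succ n ih =>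
    rw [pow_succ', mul_assoc, ← normSqMul_polyGaussian, hT.2, ih, laplacian_smul',
      laplacian_radialMul hm hH, smul_neg, neg_neg]

/-! ## Hermite functions as polynomials times the Gaussian -/

theorem laguerre_zero {α : ℝ} (hα : 0 < α + 1) (t : ℝ) : laguerre 0 α t = 1 := by
  have hG : Real.Gamma (α + 1) ≠ 0 := (Real.Gamma_pos_of_pos hα).ne'
  simp [laguerre, hG]

theorem hermite_zero {m : ℕ} (hm : 1 ≤ m) (k : ℕ) (H : MvPolynomial (Fin m) ℂ) :
    hermite m 0 k H = polyGaussian m H := by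
  ext x
  have hm' : (0 : ℝ) < m := by exact_mod_cast hm
  change hermiteFun m 0 k H x = _
  rw [polyGaussian_apply, hermiteFun, laguerre_zero (by rw [sub_add_cancel]; positivity)]
  simp [evalAt]

/-- The Laguerre coefficients stay anonymous: the final identity is linear and is checked for each
power of |x|² separately. -/
theorem exists_hermite_eq_sum {m : ℕ} (j k : ℕ) (H : MvPolynomial (Fin m) ℂ) :
    ∃ a : ℕ → ℂ, hermite m j k H
      = ∑ n ∈ Finset.range (j + 1), a n • polyGaussian m (sqNorm m ^ n * H) := by
  set α : ℝ := (m : ℝ) / 2 + k - 1 with hα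
  refine ⟨fun n => 2 ^ j * (j ! : ℂ) * ((Real.Gamma (j + α + 1)
    / ((n ! : ℝ) * ((j - n)! : ℝ) * Real.Gamma (n + α + 1)) * (-1) ^ n : ℝ) : ℂ), ?_⟩
  ext x
  change hermiteFun m j k H x = _
  rw [hermiteFun, laguerre, ← hα, sum_apply, Complex.ofReal_sum, Finset.mul_sum, Finset.sum_mul,
    Finset.sum_mul]
  refine Finset.sum_congr rfl fun n _ => ?_
  rw [smul_apply, polyGaussian_apply, map_mul, map_pow, evalAt_sqNorm, smul_eq_mul, neg_pow]
  simp only [evalAt, Complex.ofReal_mul, Complex.ofReal_pow]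
  ring

/-! ## The terms of the kernel -/

theorem neg_half_le_lam {m : ℕ} (hm : 1 ≤ m) : -1 / 2 ≤ lam m := by
  have : (1 : ℝ) ≤ m := by exact_mod_cast hm
  rw [lam]
  linarith

/-- The coefficients of `Γ(lam) (k + lam) C_k^lam(w)` as a polynomial in `w`. -/
def zonalCoeff (m k j : ℕ) : ℝ :=
  if k = 0 then Real.Gamma (lam m + 1) else
    (k + lam m) * ((-1) ^ j * Real.Gamma (k - j + lam m) * 2 ^ (k - 2 * j)
      / ((j ! : ℝ) * ((k - 2 * j)! : ℝ)))

/-- For k ≥ 1 the factor Γ(λ) cancels against the denominator, and for k = 0 one has λΓ(λ) = Γ(λ +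
1). The coefficients thus need no case distinction at λ = 0; for λ ≠ 0 no pole of Γ is met since λ ≥
-1/2. -/
theorem gammaGegenbauer_eq_sum {m : ℕ} (hm : 1 ≤ m) (k : ℕ) (w : ℝ) :
    gammaGegenbauer k (lam m) w
      = ∑ j ∈ Finset.range (k / 2 + 1), zonalCoeff m k j * w ^ (k - 2 * j) := by
  have hl := neg_half_le_lam hm
  rcases eq_or_ne (lam m) 0 with h0 | h0
  · rw [gammaGegenbauer, if_pos h0]
    rcases eq_or_ne k 0 with rfl | hk
    · simp [zonalCoeff, h0]
    · rw [if_neg hk, Finset.mul_sum]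
      refine Finset.sum_congr rfl fun j _ => ?_
      rw [zonalCoeff, if_neg hk, h0, mul_pow]
      ring_nf
  · have hG : Real.Gamma (lam m) ≠ 0 := by
      refine Real.Gamma_ne_zero fun n hn => ?_
      rcases Nat.eq_zero_or_pos n with rfl | hn0
      · simp at hn
        exact h0 hn
      · have : (1 : ℝ) ≤ n := by exact_mod_cast hn0
        linarith
    rw [gammaGegenbauer, if_neg h0, gegenbauer]
    rcases eq_or_ne k 0 with rfl | hk
    · simp [zonalCoeff, hG, Real.Gamma_add_one h0, mul_comm]
    · rw [Finset.mul_sum]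
      refine Finset.sum_congr rfl fun j _ => ?_
      rw [zonalCoeff, if_neg hk, mul_pow]
      field_simp

/-- The zonal harmonic `Γ(lam) (k + lam) (|x||y|)^k C_k^lam(⟨x,y⟩/(|x||y|))` as a polynomial
in `x`. -/
def zonalPoly (m k : ℕ) (y : E m) : MvPolynomial (Fin m) ℂ :=
  zonal k (fun j => (zonalCoeff m k j : ℂ)) (fun i => (y i : ℂ))

theorem sum_coord_sq {m : ℕ} (y : E m) : ∑ i, (y i : ℂ) ^ 2 = ((‖y‖ ^ 2 : ℝ) : ℂ) := by
  simp [EuclideanSpace.norm_sq_eq]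

theorem evalAt_linForm {m : ℕ} (x y : E m) :
    evalAt x (linForm fun i => (y i : ℂ)) = ((inner ℝ x y : ℝ) : ℂ) := by
  simp [linForm, PiLp.inner_apply]

theorem evalAt_zonalPoly {m : ℕ} (k : ℕ) (x y : E m) :
    evalAt x (zonalPoly m k y) = ((∑ j ∈ Finset.range (k / 2 + 1),
      zonalCoeff m k j * (inner ℝ x y) ^ (k - 2 * j) * (‖x‖ * ‖y‖) ^ (2 * j) : ℝ) : ℂ) := by
  rw [zonalPoly, zonal, map_sum, Complex.ofReal_sum]
  refine Finset.sum_congr rfl fun j _ => ?_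
  rw [map_mul, map_mul (evalAt x) (sqNorm m ^ j), map_pow, map_pow, evalAt_C, evalAt_linForm,
    evalAt_sqNorm, sum_coord_sq]
  push_cast
  ring

/-- With m = 2λ + 2 the recursion required for harmonicity is the functional equation of Γ at k - j
- 1 + λ, which is positive in the relevant range. -/
theorem zonalPoly_mem {m : ℕ} (hm : 1 ≤ m) (k : ℕ) (y : E m) :
    zonalPoly m k y ∈ sphericalHarmonics m k := by
  refine zonal_mem_sphericalHarmonics k _ _ fun j hj => ?_
  have hl := neg_half_le_lam hm
  have hk : k ≠ 0 := by omega
  have hjk : (2 * (j + 1) : ℝ) ≤ k := by exact_mod_cast hj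
  have hj0 : (0 : ℝ) ≤ j := j.cast_nonneg
  have hpos : 0 < (k : ℝ) - (j + 1 : ℕ) + lam m := by
    push_cast
    linarith
  have e1 : Real.Gamma (k - j + lam m)
      = (k - (j + 1 : ℕ) + lam m) * Real.Gamma (k - (j + 1 : ℕ) + lam m) := by
    rw [← Real.Gamma_add_one hpos.ne']
    push_cast
    ring_nf
  obtain ⟨r, hr⟩ : ∃ r, k = 2 * (j + 1) + r := Nat.exists_eq_add_of_le hj
  have e2 : k - 2 * (j + 1) = r := by omega
  have e3 : k - 2 * j = r + 2 := by omega
  have hm' : (m : ℝ) = 2 * lam m + 2 := by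
    rw [lam]
    ring
  have key : zonalCoeff m k (j + 1) * (2 * (j + 1) * (2 * k - 2 * j - 4 + m))
      + zonalCoeff m k j * ((k - 2 * j) * (k - 2 * j - 1)) = 0 := by
    rw [zonalCoeff, zonalCoeff, if_neg hk, if_neg hk, e1, e2, e3, Nat.factorial_succ,
      Nat.factorial_succ (r + 1), Nat.factorial_succ r, hm']
    have hkr : (k : ℝ) = 2 * (j + 1) + r := by exact_mod_cast hr
    have f1 : (j ! : ℝ) ≠ 0 := by positivity
    have f2 : (r ! : ℝ) ≠ 0 := by positivity
    have f3 : (j : ℝ) + 1 ≠ 0 := by positivity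
    have f4 : (r : ℝ) + 1 ≠ 0 := by positivity
    have f5 : (r : ℝ) + 1 + 1 ≠ 0 := by positivity
    rw [hkr]
    push_cast
    field_simp
    ring
  exact_mod_cast congrArg (fun r : ℝ => (r : ℂ)) key

/-- The constant in the reproducing property of the zonal harmonic; its Gamma value cancels in
`gaussianIntegral_zonal` against the radial moments. -/
theorem zonalCoeff_zero {m : ℕ} (hm : 1 ≤ m) (k : ℕ) :
    zonalCoeff m k 0 * (k ! : ℝ) = 2 ^ k * Real.Gamma ((m : ℝ) / 2 + k) := by
  have e : (m : ℝ) / 2 + k = k + lam m + 1 := by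
    rw [lam]
    ring
  rw [zonalCoeff, e]
  rcases eq_or_ne k 0 with rfl | hk
  · simp
  · have hl := neg_half_le_lam hm
    have : (1 : ℝ) ≤ k := by exact_mod_cast Nat.one_le_iff_ne_zero.2 hk
    have hf : (k ! : ℝ) ≠ 0 := by positivity
    rw [if_neg hk, Real.Gamma_add_one (by linarith)]
    simp
    field_simp

/-- The `n`-th coefficient of the power series of `(z/2)^(-ν) J_ν(z)` in `(z/2)²`. -/
def besselCoeff (ν : ℝ) (n : ℕ) : ℝ := (-1) ^ n / ((n ! : ℝ) * Real.Gamma (n + ν + 1))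

/-- In z^{-λ} J_{k+λ}(z) = 2^{-λ} (z/2)^k ∑ …, the power z^k clears the denominators of
C_k^λ(⟨x,y⟩/z), and 2^{-λ} cancels 2^λ. This removes the singular variable w. -/
theorem kernelTerm_eq {m : ℕ} (hm : 1 ≤ m) (μ : ℕ → ℂ) (x y : E m) (k : ℕ) :
    kernelTerm m μ x y k = evalAt x (zonalPoly m k y) *
      (((1 / 2) ^ k * ∑' n : ℕ, besselCoeff (k + lam m) n * (‖x‖ * ‖y‖ / 2) ^ (2 * n) : ℝ) : ℂ)
        * μ k := by
  rw [kernelTerm, evalAt_zonalPoly, ← Complex.ofReal_mul]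
  congr 2
  have hl := neg_half_le_lam hm
  have h2 : (2 : ℝ) ^ lam m ≠ 0 := (Real.rpow_pos_of_pos two_pos _).ne'
  rw [gammaGegenbauer_eq_sum hm]
  have hz0 : 0 ≤ ‖x‖ * ‖y‖ := by positivity
  rcases hz0.eq_or_lt with hz | hz
  -- For z = 0 the inner product vanishes too, so both sides are zero unless k = 0; the value chosen
  -- by continuity there matches the constant term of the series.
  · have hi : (inner ℝ x y : ℝ) = 0 := by
      have := abs_real_inner_le_norm x y
      rw [← hz] at this
      exact abs_nonpos_iff.1 this
    rw [← hz, hi, besselQuot, if_pos rfl]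
    rcases eq_or_ne k 0 with rfl | hk
    · have hG : Real.Gamma (lam m + 1) ≠ 0 := (Real.Gamma_pos_of_pos (by linarith)).ne'
      rw [tsum_eq_single 0 (fun n hn => by simp [hn])]
      simp [zonalCoeff, besselCoeff]
      field_simp
    · rw [if_neg hk, mul_zero, Finset.sum_eq_zero, zero_mul]
      intro j hj
      rcases Nat.eq_zero_or_pos j with rfl | hj0
      · simp [hk]
      · simp [hj0.ne']
  · rw [besselQuot, if_neg hz.ne', besselQuot_series k _ _ hz, Real.rpow_neg two_pos.le]
    have hS (n : ℕ) : (-1) ^ n / ((n ! : ℝ) * Real.Gamma (n + (k + lam m) + 1))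
        = besselCoeff (k + lam m) n := rfl
    simp only [hS]
    set z := ‖x‖ * ‖y‖
    set S := ∑' n : ℕ, besselCoeff (k + lam m) n * (z / 2) ^ (2 * n)
    have e : ∑ j ∈ Finset.range (k / 2 + 1),
        zonalCoeff m k j * (inner ℝ x y) ^ (k - 2 * j) * z ^ (2 * j)
        = z ^ k * ∑ j ∈ Finset.range (k / 2 + 1),
          zonalCoeff m k j * (inner ℝ x y / z) ^ (k - 2 * j) := by
      rw [Finset.mul_sum]
      refine Finset.sum_congr rfl fun j hj => ?_
      have hj' : k - 2 * j + 2 * j = k := by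
        have := Finset.mem_range.1 hj
        omega
      have hzk : z ^ k = z ^ (k - 2 * j) * z ^ (2 * j) := by rw [← pow_add, hj']
      rw [div_pow, hzk]
      field_simp
    rw [e, div_pow, div_pow, one_pow]
    field_simp

/-! ## Estimates -/

theorem gamma_lower_bound {ν : ℝ} (hν : -1 / 2 ≤ ν) (n : ℕ) :
    Real.Gamma (ν + 1) * ((n ! : ℝ) / 2 ^ n) ≤ Real.Gamma (n + ν + 1) := by
  induction n with
  | zero => simp
  | succ n ih =>
    have hn : (0 : ℝ) ≤ n := n.cast_nonneg
    have e : Real.Gamma ((n + 1 : ℕ) + ν + 1) = (n + ν + 1) * Real.Gamma (n + ν + 1) := by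
      rw [← Real.Gamma_add_one (by linarith)]
      push_cast
      ring_nf
    have hG : 0 < Real.Gamma (ν + 1) := Real.Gamma_pos_of_pos (by linarith)
    rw [e, Nat.factorial_succ]
    calc Real.Gamma (ν + 1) * (((n + 1) * n ! : ℕ) / 2 ^ (n + 1))
        = ((n + 1 : ℝ) / 2) * (Real.Gamma (ν + 1) * ((n ! : ℝ) / 2 ^ n)) := by
          push_cast
          rw [pow_succ]
          field_simp
      _ ≤ (n + ν + 1) * Real.Gamma (n + ν + 1) := by
          refine mul_le_mul (by linarith) ih (by positivity) (by linarith)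

/-- By (2n)! ≤ 4^n (n!)² the term is at most a multiple of (4z)^{2n}/(2n)! · 8^{-n}. Growth of order
e^{4z}, rather than e^{z²}, matters: it is integrable against the Gaussian for every y. -/
theorem besselCoeff_bound {ν : ℝ} (hν : -1 / 2 ≤ ν) (n : ℕ) {z : ℝ} (hz : 0 ≤ z) :
    |besselCoeff ν n * (z / 2) ^ (2 * n)|
      ≤ (1 / Real.Gamma (ν + 1)) * Real.exp (4 * z) * (1 / 4) ^ n := by
  have hn : (0 : ℝ) ≤ n := n.cast_nonneg
  have hG : 0 < Real.Gamma (ν + 1) := Real.Gamma_pos_of_pos (by linarith)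
  have hGn : 0 < Real.Gamma (n + ν + 1) := Real.Gamma_pos_of_pos (by linarith)
  have h1 := gamma_lower_bound hν n
  have hfac : ((2 * n)! : ℝ) ≤ 4 ^ n * ((n ! : ℝ) * n !) := by
    have h := Nat.add_choose_mul_factorial_mul_factorial n n
    have h2 : (n + n).choose n ≤ 2 ^ (n + n) := Nat.choose_le_two_pow _ _
    have h3 : ((2 * n)! : ℝ) = ((n + n).choose n : ℝ) * n ! * n ! := by
      rw [two_mul]
      exact_mod_cast h.symm
    have h4 : ((n + n).choose n : ℝ) ≤ 4 ^ n := by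
      have e : (4 : ℝ) ^ n = 2 ^ (n + n) := by
        rw [← two_mul, pow_mul]
        norm_num
      rw [e]
      exact_mod_cast h2
    rw [h3, mul_assoc]
    gcongr
  have h2 := Real.pow_div_factorial_le_exp (4 * z) (by positivity) (2 * n)
  rw [besselCoeff, abs_mul, abs_div, abs_pow, abs_neg, abs_one, one_pow,
    abs_of_pos (by positivity), abs_of_nonneg (by positivity)]
  calc 1 / ((n ! : ℝ) * Real.Gamma (n + ν + 1)) * (z / 2) ^ (2 * n)
      ≤ 1 / ((n ! : ℝ) * (Real.Gamma (ν + 1) * ((n ! : ℝ) / 2 ^ n))) * (z / 2) ^ (2 * n) := by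
        gcongr
    _ = (1 / Real.Gamma (ν + 1)) * ((z / 2) ^ (2 * n) * 2 ^ n * (1 / ((n ! : ℝ) * n !))) := by
        field_simp
    _ ≤ (1 / Real.Gamma (ν + 1)) * ((z / 2) ^ (2 * n) * 2 ^ n * (4 ^ n / (2 * n)!)) := by
        gcongr _ * (_ * ?_)
        rw [div_le_div_iff₀ (by positivity) (by positivity)]
        linarith
    _ = (1 / Real.Gamma (ν + 1)) * ((4 * z) ^ (2 * n) / (2 * n)! * ((1 / 4) ^ n * (1 / 2) ^ n)) := by
        have : (z / 2) ^ (2 * n) * 2 ^ n * 4 ^ n = (4 * z) ^ (2 * n) * ((1 / 4) ^ n * (1 / 2) ^ n) := by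
          rw [pow_mul, pow_mul, ← mul_pow, ← mul_pow, ← mul_pow, ← mul_pow]
          congr 1
          ring
        rw [mul_div_assoc', this]
        ring
    _ ≤ (1 / Real.Gamma (ν + 1)) * (Real.exp (4 * z) * ((1 / 4) ^ n * 1)) := by
        gcongr
        exact pow_le_one₀ (by norm_num) (by norm_num)
    _ = _ := by ring

/-- The bookkeeping for dominated convergence, with u = |x| and v = |y|. The extra u²/4 brings the
majorant into the form shared with the sum over degrees. -/
theorem mul_besselCoeff_le {ν : ℝ} (hν : -1 / 2 ≤ ν) (k i : ℕ) {u v A M B : ℝ} (hu : 0 ≤ u)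
    (hv : 0 ≤ v) (hA : 0 ≤ A) (hM : 0 ≤ M) (hB : 0 ≤ B) :
    A * ((1 / 2) ^ k * |besselCoeff ν i * (u * v / 2) ^ (2 * i)|) * M * B
      ≤ (1 / 2) ^ k * (1 / Real.Gamma (ν + 1)) * M * (Real.exp (u ^ 2 / 4 + 4 * v * u) * (A * B))
        * (1 / 4) ^ i := by
  have hG : 0 < Real.Gamma (ν + 1) := Real.Gamma_pos_of_pos (by linarith)
  have hexp : Real.exp (4 * (u * v)) ≤ Real.exp (u ^ 2 / 4 + 4 * v * u) :=
    Real.exp_le_exp.2 (by nlinarith [sq_nonneg u])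
  calc A * ((1 / 2) ^ k * |besselCoeff ν i * (u * v / 2) ^ (2 * i)|) * M * B
      ≤ A * ((1 / 2) ^ k * ((1 / Real.Gamma (ν + 1)) * Real.exp (4 * (u * v)) * (1 / 4) ^ i))
        * M * B := by
        gcongr
        exact besselCoeff_bound hν i (by positivity)
    _ ≤ A * ((1 / 2) ^ k * ((1 / Real.Gamma (ν + 1)) * Real.exp (u ^ 2 / 4 + 4 * v * u)
        * (1 / 4) ^ i)) * M * B := by
        gcongr
    _ = _ := by ring

theorem summable_besselCoeff {ν : ℝ} (hν : -1 / 2 ≤ ν) {z : ℝ} (hz : 0 ≤ z) :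
    Summable fun n => besselCoeff ν n * (z / 2) ^ (2 * n) :=
  Summable.of_norm_bounded ((summable_geometric_of_lt_one (by norm_num) (by norm_num)).mul_left _)
    fun n => besselCoeff_bound hν n hz

theorem tsum_besselCoeff_bound {ν : ℝ} (hν : -1 / 2 ≤ ν) {z : ℝ} (hz : 0 ≤ z) :
    |∑' n, besselCoeff ν n * (z / 2) ^ (2 * n)| ≤ (2 / Real.Gamma (ν + 1)) * Real.exp (4 * z) := by
  have hG : 0 < Real.Gamma (ν + 1) := Real.Gamma_pos_of_pos (by linarith)
  have h := tsum_of_norm_bounded (f := fun n => besselCoeff ν n * (z / 2) ^ (2 * n))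
    ((hasSum_geometric_of_lt_one (r := (1 / 4 : ℝ)) (by norm_num) (by norm_num)).mul_left
      ((1 / Real.Gamma (ν + 1)) * Real.exp (4 * z))) fun n => besselCoeff_bound hν n hz
  refine h.trans ?_
  have : (1 / Real.Gamma (ν + 1)) * Real.exp (4 * z) * (1 - 1 / 4)⁻¹
      = (4 / 3 / Real.Gamma (ν + 1)) * Real.exp (4 * z) := by
    field_simp
    norm_num
  rw [this]
  gcongr
  norm_num

theorem gamma_upper_bound {l : ℝ} (hl : -1 / 2 ≤ l) (n : ℕ) :
    Real.Gamma ((n + 1 : ℕ) + l) ≤ Real.Gamma (l + 1) * (1 + |l|) ^ n * (n ! : ℝ) := by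
  induction n with
  | zero => simp [add_comm]
  | succ n ih =>
    have hn : (0 : ℝ) ≤ n := n.cast_nonneg
    have e : Real.Gamma ((n + 1 + 1 : ℕ) + l) = ((n + 1 : ℕ) + l) * Real.Gamma ((n + 1 : ℕ) + l) := by
      rw [← Real.Gamma_add_one (by push_cast; linarith)]
      push_cast
      ring_nf
    have hG : 0 < Real.Gamma (l + 1) := Real.Gamma_pos_of_pos (by linarith)
    rw [e, Nat.factorial_succ]
    calc ((n + 1 : ℕ) + l) * Real.Gamma ((n + 1 : ℕ) + l)
        ≤ ((n + 1) * (1 + |l|)) * (Real.Gamma (l + 1) * (1 + |l|) ^ n * (n ! : ℝ)) := by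
          refine mul_le_mul ?_ ih (Real.Gamma_pos_of_pos (by push_cast; linarith)).le (by positivity)
          push_cast
          nlinarith [le_abs_self l, abs_nonneg l]
      _ = _ := by
          push_cast
          ring

/-- The factor 8^k collects one 2^k each from k + λ, from the binomial bound for the factorial
quotient, and from 2^{k-2j}. -/
theorem zonalCoeff_bound {m : ℕ} (hm : 1 ≤ m) {k j : ℕ} (hj : 2 * j ≤ k) :
    |zonalCoeff m k j|
      ≤ Real.Gamma (lam m + 1) * (1 + |lam m|) * (8 * (1 + |lam m|)) ^ k := by
  have hl := neg_half_le_lam hm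
  have hG : 0 < Real.Gamma (lam m + 1) := Real.Gamma_pos_of_pos (by linarith)
  have hL : 1 ≤ 1 + |lam m| := by linarith [abs_nonneg (lam m)]
  set L := 1 + |lam m| with hLdef
  rcases eq_or_ne k 0 with rfl | hk
  · rw [zonalCoeff, if_pos rfl, abs_of_pos hG]
    simp only [pow_zero, mul_one]
    exact le_mul_of_one_le_right hG.le hL
  · obtain ⟨r, hr⟩ : ∃ r, k = 2 * j + r := Nat.exists_eq_add_of_le hj
    obtain ⟨q, hq⟩ : ∃ q, j + r = q + 1 := Nat.exists_eq_add_one.2 (by omega)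
    have e1 : (k : ℝ) - j + lam m = (q + 1 : ℕ) + lam m := by
      rw [← hq, hr]
      push_cast
      ring
    have e2 : k - 2 * j = r := by omega
    have h1 := gamma_upper_bound hl q
    have hk1 : (1 : ℝ) ≤ k := by exact_mod_cast Nat.one_le_iff_ne_zero.2 hk
    have hkl : 0 < k + lam m := by linarith
    have hpos : 0 < Real.Gamma ((q + 1 : ℕ) + lam m) :=
      Real.Gamma_pos_of_pos (by push_cast; linarith [(q.cast_nonneg : (0 : ℝ) ≤ q)])
    have hqf : (q ! : ℝ) ≤ 2 ^ k * ((j ! : ℝ) * r !) := by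
      have h2 := Nat.add_choose_mul_factorial_mul_factorial j r
      have h3 : (j + r).choose r ≤ 2 ^ k :=
        (Nat.choose_le_two_pow _ _).trans (Nat.pow_le_pow_right two_pos (by omega))
      have h4 : q ! ≤ (j + r)! := Nat.factorial_le (by omega)
      have h5 : q ! ≤ 2 ^ k * (j ! * r !) := by
        refine h4.trans ?_
        rw [← h2, mul_assoc]
        exact Nat.mul_le_mul_right _ h3
      exact_mod_cast h5
    have hk2 : (k : ℝ) + lam m ≤ 2 ^ k * L := by
      have : (k : ℝ) + 1 ≤ 2 ^ k := by exact_mod_cast Nat.lt_two_pow_self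
      nlinarith [le_abs_self (lam m), abs_nonneg (lam m)]
    rw [zonalCoeff, if_neg hk, e1, e2, abs_mul, abs_div, abs_mul, abs_mul, abs_pow, abs_neg, abs_one,
      one_pow, one_mul, abs_of_pos hkl, abs_of_pos hpos, abs_of_pos (by positivity : (0 : ℝ) < 2 ^ r),
      abs_of_pos (by positivity : (0 : ℝ) < (j ! : ℝ) * r !)]
    calc (k + lam m) * (Real.Gamma ((q + 1 : ℕ) + lam m) * 2 ^ r / ((j ! : ℝ) * r !))
        ≤ (2 ^ k * L) * ((Real.Gamma (lam m + 1) * L ^ k * (2 ^ k * ((j ! : ℝ) * r !))) * 2 ^ k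
            / ((j ! : ℝ) * r !)) := by
          have hP : L ^ q ≤ L ^ k := pow_le_pow_right₀ hL (by omega)
          have hr2 : (2 : ℝ) ^ r ≤ 2 ^ k := pow_le_pow_right₀ (by norm_num) (by omega)
          have h6 := h1.trans (mul_le_mul (mul_le_mul_of_nonneg_left hP hG.le) hqf (by positivity)
            (by positivity))
          gcongr
      _ = Real.Gamma (lam m + 1) * L * (8 * L) ^ k := by
          have : (8 : ℝ) ^ k = 2 ^ k * 2 ^ k * 2 ^ k := by
            rw [← mul_pow, ← mul_pow]
            norm_num
          rw [mul_pow, this]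
          field_simp

theorem exists_zonalPoly_bound {m : ℕ} (hm : 1 ≤ m) :
    ∃ C A : ℝ, 0 < C ∧ 0 < A ∧ ∀ (k : ℕ) (x y : E m),
      ‖evalAt x (zonalPoly m k y)‖ ≤ C * (A * (‖x‖ * ‖y‖)) ^ k := by
  have hl := neg_half_le_lam hm
  have hG : 0 < Real.Gamma (lam m + 1) := Real.Gamma_pos_of_pos (by linarith)
  refine ⟨Real.Gamma (lam m + 1) * (1 + |lam m|), 2 * (8 * (1 + |lam m|)), by positivity,
    by positivity, fun k x y => ?_⟩
  rw [evalAt_zonalPoly, Complex.norm_real, Real.norm_eq_abs]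
  have hk : ((k / 2 + 1 : ℕ) : ℝ) ≤ 2 ^ k := by
    have : k / 2 + 1 ≤ 2 ^ k := by
      have := (Nat.lt_two_pow_self : k < 2 ^ k)
      omega
    exact_mod_cast this
  have h : ∀ j ∈ Finset.range (k / 2 + 1),
      |zonalCoeff m k j * (inner ℝ x y) ^ (k - 2 * j) * (‖x‖ * ‖y‖) ^ (2 * j)|
      ≤ Real.Gamma (lam m + 1) * (1 + |lam m|) * (8 * (1 + |lam m|)) ^ k * (‖x‖ * ‖y‖) ^ k := by
    intro j hj
    have hj' : 2 * j ≤ k := by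
      have := Finset.mem_range.1 hj
      omega
    have e : (‖x‖ * ‖y‖) ^ k = (‖x‖ * ‖y‖) ^ (k - 2 * j) * (‖x‖ * ‖y‖) ^ (2 * j) := by
      rw [← pow_add]
      congr 1
      omega
    rw [abs_mul, abs_mul, abs_pow, abs_of_nonneg (by positivity : 0 ≤ (‖x‖ * ‖y‖) ^ (2 * j)), e,
      ← mul_assoc]
    gcongr
    · exact zonalCoeff_bound hm hj'
    · exact abs_real_inner_le_norm x y
  refine (Finset.abs_sum_le_sum_abs _ _).trans ((Finset.sum_le_sum h).trans ?_)
  rw [Finset.sum_const, Finset.card_range, nsmul_eq_mul]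
  calc ((k / 2 + 1 : ℕ) : ℝ) * (Real.Gamma (lam m + 1) * (1 + |lam m|) * (8 * (1 + |lam m|)) ^ k
        * (‖x‖ * ‖y‖) ^ k)
      ≤ 2 ^ k * (Real.Gamma (lam m + 1) * (1 + |lam m|) * (8 * (1 + |lam m|)) ^ k
        * (‖x‖ * ‖y‖) ^ k) := by gcongr
    _ = _ := by
        rw [mul_pow _ (‖x‖ * ‖y‖), mul_pow 2]
        ring

/-- The decisive 1/k! comes from 1/Γ(k + λ + 1) in the Bessel series; the 2^k lost in
`gamma_lower_bound` is compensated by the factor (1/2)^k. -/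
theorem exists_kernelTerm_bound {m : ℕ} (hm : 1 ≤ m) :
    ∃ C A : ℝ, 0 < C ∧ 0 < A ∧ ∀ (μ : ℕ → ℂ) (k : ℕ) (x y : E m),
      ‖kernelTerm m μ x y k‖
        ≤ C * Real.exp (4 * (‖x‖ * ‖y‖)) * ((A * (‖x‖ * ‖y‖)) ^ k / k !) * ‖μ k‖ := by
  obtain ⟨C, A, hC, hA, h⟩ := exists_zonalPoly_bound hm
  have hl := neg_half_le_lam hm
  have hG : 0 < Real.Gamma (lam m + 1) := Real.Gamma_pos_of_pos (by linarith)
  refine ⟨C * (2 / Real.Gamma (lam m + 1)), A, by positivity, hA, fun μ k x y => ?_⟩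
  have hν : -1 / 2 ≤ k + lam m := by linarith [(k.cast_nonneg : (0 : ℝ) ≤ k)]
  have h1 := tsum_besselCoeff_bound hν (z := ‖x‖ * ‖y‖) (by positivity)
  have h2 := gamma_lower_bound hl k
  rw [kernelTerm_eq hm, norm_mul, norm_mul, Complex.norm_real, Real.norm_eq_abs, abs_mul,
    abs_of_pos (by positivity : (0 : ℝ) < (1 / 2) ^ k)]
  refine mul_le_mul_of_nonneg_right ?_ (norm_nonneg _)
  calc ‖evalAt x (zonalPoly m k y)‖ * ((1 / 2) ^ k *
        |∑' n, besselCoeff (k + lam m) n * (‖x‖ * ‖y‖ / 2) ^ (2 * n)|)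
      ≤ (C * (A * (‖x‖ * ‖y‖)) ^ k) * ((1 / 2) ^ k *
        ((2 / (Real.Gamma (lam m + 1) * ((k ! : ℝ) / 2 ^ k))) * Real.exp (4 * (‖x‖ * ‖y‖)))) := by
        gcongr
        · exact h k x y
        · refine h1.trans ?_
          gcongr
    _ = _ := by
        rw [div_pow, one_pow]
        field_simp

theorem exists_evalAt_bound {m : ℕ} (p : MvPolynomial (Fin m) ℂ) :
    ∃ C N : ℝ, 0 ≤ C ∧ 0 ≤ N ∧ ∀ x : E m, ‖evalAt x p‖ ≤ C * Real.exp (N * ‖x‖) := by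
  induction p using MvPolynomial.induction_on with
  | C a => exact ⟨‖a‖, 0, norm_nonneg _, le_rfl, fun x => by simp⟩
  | add p q hp hq =>
    obtain ⟨C, N, hC, hN, h⟩ := hp
    obtain ⟨D, M, hD, hM, h'⟩ := hq
    refine ⟨C + D, N + M, by positivity, by positivity, fun x => ?_⟩
    rw [map_add, add_mul]
    refine (norm_add_le _ _).trans (add_le_add ((h x).trans ?_) ((h' x).trans ?_))
    · gcongr
      linarith
    · gcongr
      linarith
  | mul_X p i hp =>
    obtain ⟨C, N, hC, hN, h⟩ := hp
    refine ⟨C, N + 1, hC, by positivity, fun x => ?_⟩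
    rw [map_mul, norm_mul, evalAt_X, Complex.norm_real, add_mul, Real.exp_add, one_mul, ← mul_assoc]
    refine mul_le_mul (h x) ((PiLp.norm_apply_le x i).trans ?_) (norm_nonneg _) (by positivity)
    linarith [Real.add_one_le_exp ‖x‖]

theorem integrable_exp_mul_polyGaussian {m : ℕ} (c : ℝ) (p : MvPolynomial (Fin m) ℂ) :
    Integrable fun x : E m => Real.exp (‖x‖ ^ 2 / 4 + c * ‖x‖) * ‖polyGaussian m p x‖ := by
  obtain ⟨C, N, hC, hN, h⟩ := exists_evalAt_bound p
  have hg : Integrable fun x : E m => Real.exp (-(1 / 8) * ‖x‖ ^ 2) := by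
    have := GaussianFourier.integrable_cexp_neg_mul_sq_norm_add (V := E m) (b := (1 / 8 : ℂ))
      (by norm_num) 0 0
    refine this.norm.congr (Filter.Eventually.of_forall fun x => ?_)
    simp [Complex.norm_exp, ← Complex.ofReal_pow]
  refine Integrable.mono' (hg.const_mul (C * Real.exp (2 * (c + N) ^ 2))) ?_ ?_
  · have : Continuous (polyGaussian m p) := (polyGaussian m p).continuous
    exact Continuous.aestronglyMeasurable (by fun_prop)
  · refine Filter.Eventually.of_forall fun x => ?_
    rw [norm_mul, norm_norm, Real.norm_of_nonneg (Real.exp_pos _).le, polyGaussian_apply, norm_mul,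
      Complex.norm_real, Real.norm_of_nonneg (Real.exp_pos _).le]
    calc Real.exp (‖x‖ ^ 2 / 4 + c * ‖x‖) * (‖evalAt x p‖ * Real.exp (-‖x‖ ^ 2 / 2))
        ≤ Real.exp (‖x‖ ^ 2 / 4 + c * ‖x‖) * ((C * Real.exp (N * ‖x‖)) * Real.exp (-‖x‖ ^ 2 / 2)) := by
          gcongr
          exact h x
      _ = C * Real.exp ((‖x‖ ^ 2 / 4 + c * ‖x‖) + N * ‖x‖ + -‖x‖ ^ 2 / 2) := by
          rw [Real.exp_add (‖x‖ ^ 2 / 4 + c * ‖x‖ + N * ‖x‖), Real.exp_add (‖x‖ ^ 2 / 4 + c * ‖x‖)]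
          ring
      _ ≤ C * Real.exp (2 * (c + N) ^ 2 + -(1 / 8) * ‖x‖ ^ 2) := by
          refine mul_le_mul_of_nonneg_left (Real.exp_le_exp.2 ?_) hC
          -- Half of the available -|x|²/4 is spent on the linear term (c + N)|x| by completing the
          -- square.
          nlinarith [sq_nonneg (‖x‖ - 4 * (c + N))]
      _ = _ := by
          rw [Real.exp_add]
          ring

/-! ## The integral of a single term -/

theorem prod_eq_gamma {β : ℝ} (hβ : 0 < β) (n : ℕ) :
    ∏ i ∈ Finset.range n, (2 * β + 2 * i) = 2 ^ n * (Real.Gamma (n + β) / Real.Gamma β) := by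
  have hG : Real.Gamma β ≠ 0 := (Real.Gamma_pos_of_pos hβ).ne'
  induction n with
  | zero => simp [hG]
  | succ n ih =>
    have e : Real.Gamma ((n + 1 : ℕ) + β) = (n + β) * Real.Gamma (n + β) := by
      rw [← Real.Gamma_add_one (by positivity)]
      push_cast
      ring_nf
    rw [Finset.prod_range_succ, ih, e, pow_succ]
    ring

theorem gaussianIntegral_zonal {m : ℕ} (hm : 1 ≤ m) {k l : ℕ} {H : MvPolynomial (Fin m) ℂ}
    (hH : H ∈ sphericalHarmonics m l) (y : E m) (n : ℕ) :
    gaussianIntegral m (sqNorm m ^ n * (zonalPoly m k y * H))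
      = if k = l then ((2 ^ (n + k) * Real.Gamma (n + ((m : ℝ) / 2 + k)) : ℝ) : ℂ) * evalAt y H
        else 0 := by
  have hI := isGaussianFunctional_gaussianIntegral m
  have hZ := zonalPoly_mem hm k y
  rw [hI.sqNorm_pow_mul ((mem_sphericalHarmonics.1 hZ).1.mul (mem_sphericalHarmonics.1 hH).1)]
  split_ifs with hkl
  · subst hkl
    have hm' : (0 : ℝ) < m := by exact_mod_cast hm
    set β : ℝ := (m : ℝ) / 2 + k with hβ
    have hβ0 : 0 < β := by positivity
    have hG : Real.Gamma β ≠ 0 := (Real.Gamma_pos_of_pos hβ0).ne'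
    have h1 := prod_eq_gamma hβ0 n
    have h2 : ∏ i ∈ Finset.range n, (((k + k : ℕ) : ℂ) + m + 2 * i)
        = ((∏ i ∈ Finset.range n, (2 * β + 2 * i) : ℝ) : ℂ) := by
      push_cast
      refine Finset.prod_congr rfl fun i _ => ?_
      rw [hβ]
      push_cast
      ring
    have h3 := zonalCoeff_zero hm k
    have h4 : (zonalCoeff m k 0 : ℂ) * (k ! : ℂ) = ((2 ^ k * Real.Gamma β : ℝ) : ℂ) := by
      rw [← h3]
      push_cast
      rfl
    rw [h2, h1, zonalPoly, hI.zonal_mul k _ _ hH, h4, ← mul_assoc, ← Complex.ofReal_mul]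
    congr 2
    rw [pow_add]
    field_simp
  · rw [hI.harmonic_mul_harmonic hkl hZ hH, mul_zero]

/-- A Funk–Hecke formula for one degree. The Bessel series is integrated term by term; 1/Γ(i + k + λ
+ 1) and the moment Γ(i + n + m/2 + k) form the quotient summed in `hasSum_radialCoeff`, since λ + 1
= m/2. -/
theorem integral_kernelTerm_mul {m : ℕ} (hm : 1 ≤ m) (μ : ℕ → ℂ) {k l : ℕ}
    {H : MvPolynomial (Fin m) ℂ} (hH : H ∈ sphericalHarmonics m l) (y : E m) (n : ℕ) :
    (1 / ((2 * Real.pi) ^ ((m : ℝ) / 2) : ℝ) : ℂ) *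
        ∫ x, kernelTerm m μ x y k * polyGaussian m (sqNorm m ^ n * H) x
      = if k = l then μ k * polyGaussian m (radialMul ((m : ℝ) / 2 + k) n H) y else 0 := by
  have hm' : (0 : ℝ) < m := by exact_mod_cast hm
  have hl := neg_half_le_lam hm
  have hν : -1 / 2 ≤ k + lam m := by linarith [(k.cast_nonneg : (0 : ℝ) ≤ k)]
  have eβ : (k : ℝ) + lam m + 1 = (m : ℝ) / 2 + k := by
    rw [lam]
    ring
  set a : ℕ → ℝ := fun i => (1 / 2) ^ k * besselCoeff (k + lam m) i * (‖y‖ ^ 2 / 4) ^ i with ha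
  set P := zonalPoly m k y * H with hP
  -- Since z^{2i} = |x|^{2i} |y|^{2i}, the i-th Bessel term times the test function is again a
  -- polynomial times the Gaussian.
  set F : ℕ → E m → ℂ := fun i x =>
    ((a i : ℂ) * μ k) * polyGaussian m (sqNorm m ^ (i + n) * P) x with hF
  have hFx (i : ℕ) (x : E m) : F i x = evalAt x (zonalPoly m k y) *
      (((1 / 2) ^ k * (besselCoeff (k + lam m) i * (‖x‖ * ‖y‖ / 2) ^ (2 * i)) : ℝ) : ℂ) * μ k
        * polyGaussian m (sqNorm m ^ n * H) x := by
    simp only [hF, ha, hP, polyGaussian_apply, map_mul, map_pow, evalAt_sqNorm]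
    have : (‖x‖ * ‖y‖ / 2) ^ (2 * i) = (‖y‖ ^ 2 / 4) ^ i * (‖x‖ ^ 2) ^ i := by
      rw [pow_mul, ← mul_pow]
      congr 1
      ring
    rw [this]
    push_cast
    ring
  set K : ℝ := (1 / 2) ^ k * (1 / Real.Gamma (k + lam m + 1)) * ‖μ k‖ with hK
  set G : E m → ℝ := fun x => K * (Real.exp (‖x‖ ^ 2 / 4 + (4 * ‖y‖) * ‖x‖)
    * ‖polyGaussian m (sqNorm m ^ n * P) x‖) with hGdef
  have hGi : Integrable G := (integrable_exp_mul_polyGaussian _ _).const_mul K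
  have hgeo := hasSum_geometric_of_lt_one (r := (1 / 4 : ℝ)) (by norm_num) (by norm_num)
  have hmain : HasSum (fun i => ∫ x, F i x)
      (∫ x, kernelTerm m μ x y k * polyGaussian m (sqNorm m ^ n * H) x) := by
    refine hasSum_integral_of_dominated_convergence (fun i x => G x * (1 / 4) ^ i) ?_ ?_ ?_ ?_ ?_
    · intro i
      exact (continuous_const.mul
        (polyGaussian m (sqNorm m ^ (i + n) * P)).continuous).aestronglyMeasurable
    · intro i
      refine Filter.Eventually.of_forall fun x => ?_
      have e1 : ‖polyGaussian m (sqNorm m ^ n * P) x‖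
          = ‖evalAt x (zonalPoly m k y)‖ * ‖polyGaussian m (sqNorm m ^ n * H) x‖ := by
        rw [← norm_mul, polyGaussian_apply, polyGaussian_apply, hP, map_mul, map_mul, map_mul]
        congr 1
        ring
      rw [hFx, norm_mul, norm_mul, norm_mul, Complex.norm_real, Real.norm_eq_abs, abs_mul,
        abs_of_pos (by positivity : (0 : ℝ) < (1 / 2) ^ k)]
      simp only [hGdef, hK]
      rw [e1]
      exact mul_besselCoeff_le hν k i (norm_nonneg x) (norm_nonneg y) (norm_nonneg _)
        (norm_nonneg _) (norm_nonneg _)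
    · exact Filter.Eventually.of_forall fun x => hgeo.summable.mul_left _
    · simp only [tsum_mul_left]
      exact hGi.mul_const _
    · refine Filter.Eventually.of_forall fun x => ?_
      simp only [hFx]
      rw [kernelTerm_eq hm]
      have hs := (summable_besselCoeff hν (z := ‖x‖ * ‖y‖) (by positivity)).hasSum.mul_left
        ((1 / 2 : ℝ) ^ k)
      exact (((Complex.hasSum_ofReal.2 hs).mul_left _).mul_right _).mul_right _
  have hval (i : ℕ) : (1 / ((2 * Real.pi) ^ ((m : ℝ) / 2) : ℝ) : ℂ) * ∫ x, F i x
      = if k = l then ((2 ^ n * (Real.Gamma (i + n + ((m : ℝ) / 2 + k))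
          / Real.Gamma (i + ((m : ℝ) / 2 + k))) * ((-‖y‖ ^ 2 / 2) ^ i / i !) : ℝ) : ℂ)
            * (μ k * evalAt y H) else 0 := by
    simp only [hF]
    rw [integral_const_mul, mul_left_comm, ← gaussianIntegral_apply, hP,
      gaussianIntegral_zonal hm hH]
    split_ifs with hkl
    · have : a i * (2 ^ (i + n + k) * Real.Gamma ((i + n : ℕ) + ((m : ℝ) / 2 + k)))
          = 2 ^ n * (Real.Gamma (i + n + ((m : ℝ) / 2 + k))
          / Real.Gamma (i + ((m : ℝ) / 2 + k))) * ((-‖y‖ ^ 2 / 2) ^ i / i !) := by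
        simp only [ha, besselCoeff]
        have e1 : (i : ℝ) + (k + lam m) + 1 = i + ((m : ℝ) / 2 + k) := by
          rw [← eβ]
          ring
        have e2 : (-‖y‖ ^ 2 / 2) ^ i = (-1) ^ i * (‖y‖ ^ 2 / 4) ^ i * 2 ^ i := by
          rw [← mul_pow, ← mul_pow]
          congr 1
          ring
        have hG1 : Real.Gamma (i + ((m : ℝ) / 2 + k)) ≠ 0 :=
          (Real.Gamma_pos_of_pos (by positivity)).ne'
        rw [e1, e2, pow_add, pow_add, div_pow, one_pow]
        push_cast
        field_simp
      rw [← this]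
      push_cast
      ring
    · simp
  have hfin := hmain.mul_left (1 / ((2 * Real.pi) ^ ((m : ℝ) / 2) : ℝ) : ℂ)
  simp only [hval] at hfin
  split_ifs at hfin ⊢ with hkl
  · have h2 := (Complex.hasSum_ofReal.2 (hasSum_radialCoeff
      (by positivity : (0 : ℝ) < (m : ℝ) / 2 + k) n (‖y‖ ^ 2))).mul_right (μ k * evalAt y H)
    rw [hfin.unique h2, polyGaussian_apply, evalAt_radialMul]
    push_cast
    ring
  · exact hfin.unique hasSum_zero

/-! ## Summation over the degrees -/

theorem pow_le_sqrt_factorial_mul_exp {t : ℝ} (ht : 0 ≤ t) (k : ℕ) :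
    t ^ k ≤ √(k ! : ℝ) * Real.exp (t ^ 2 / 2) := by
  have h := Real.pow_div_factorial_le_exp (t ^ 2) (by positivity) k
  rw [div_le_iff₀ (by positivity)] at h
  refine (pow_le_pow_iff_left₀ (by positivity) (by positivity) two_ne_zero).1 ?_
  rw [mul_pow, Real.sq_sqrt (by positivity), ← Real.exp_nat_mul, ← pow_mul, mul_comm k 2, pow_mul]
  push_cast
  rw [mul_div_cancel₀ _ (two_ne_zero' ℝ)]
  linarith

/-- Slow growth of a sequence: `μ_k b^k = O(√k!)` for all `b`. -/
def SlowGrowth (μ : ℕ → ℂ) : Prop :=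
  ∀ b : ℝ, 0 < b → ∃ C : ℝ, ∀ k, ‖μ k‖ * b ^ k ≤ C * √(k ! : ℝ)

theorem SlowGrowth.exists_kernelTerm_le {m : ℕ} (hm : 1 ≤ m) {μ : ℕ → ℂ} (hμ : SlowGrowth μ)
    (y : E m) : ∃ C : ℝ, 0 ≤ C ∧ ∀ (x : E m) (k : ℕ),
      ‖kernelTerm m μ x y k‖ ≤ C * Real.exp (‖x‖ ^ 2 / 4 + (4 * ‖y‖) * ‖x‖) * (1 / 2) ^ k := by
  obtain ⟨C, A, hC, hA, h⟩ := exists_kernelTerm_bound hm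
  -- Chosen so that t = 2A|x||y|/b is at most (2/3)|x|, whence t²/2 ≤ |x|²/4. The summand 1 keeps b
  -- positive at y = 0, and the 2 in t leaves the geometric factor (1/2)^k.
  set b : ℝ := 3 * (A * ‖y‖) + 1 with hb
  have hb0 : 0 < b := by positivity
  obtain ⟨D, hD⟩ := hμ b hb0
  have hD0 : 0 ≤ D := by
    have := hD 0
    simp at this
    exact (norm_nonneg _).trans this
  refine ⟨C * D, by positivity, fun x k => (h μ k x y).trans ?_⟩
  set t : ℝ := 2 * (A * (‖x‖ * ‖y‖)) / b with ht
  have h1 := pow_le_sqrt_factorial_mul_exp (t := t) (by positivity) k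
  have h2 : t ^ 2 / 2 ≤ ‖x‖ ^ 2 / 4 := by
    have e : t ≤ 2 / 3 * ‖x‖ := by
      rw [ht, div_le_iff₀ hb0, hb]
      nlinarith [norm_nonneg x, norm_nonneg y, hA]
    have := pow_le_pow_left₀ (by positivity : 0 ≤ t) e 2
    nlinarith [sq_nonneg ‖x‖]
  have h3 : t ^ k ≤ √(k ! : ℝ) * Real.exp (‖x‖ ^ 2 / 4) :=
    h1.trans (mul_le_mul_of_nonneg_left (Real.exp_le_exp.2 h2) (Real.sqrt_nonneg _))
  have h4 : (A * (‖x‖ * ‖y‖)) ^ k = (1 / 2) ^ k * t ^ k * b ^ k := by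
    rw [← mul_pow, ← mul_pow, ht]
    congr 1
    field_simp
  have hf : √(k ! : ℝ) * √(k ! : ℝ) = k ! := Real.mul_self_sqrt (by positivity)
  have hk : (0 : ℝ) < k ! := by positivity
  calc C * Real.exp (4 * (‖x‖ * ‖y‖)) * ((A * (‖x‖ * ‖y‖)) ^ k / k !) * ‖μ k‖
      = C * Real.exp (4 * (‖x‖ * ‖y‖)) * (1 / 2) ^ k / k ! * (t ^ k * (‖μ k‖ * b ^ k)) := by
        rw [h4]
        ring
    _ ≤ C * Real.exp (4 * (‖x‖ * ‖y‖)) * (1 / 2) ^ k / k ! *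
        ((√(k ! : ℝ) * Real.exp (‖x‖ ^ 2 / 4)) * (D * √(k ! : ℝ))) := by
        refine mul_le_mul_of_nonneg_left (mul_le_mul h3 (hD k) (by positivity) (by positivity))
          (by positivity)
    _ = C * Real.exp (4 * (‖x‖ * ‖y‖)) * (1 / 2) ^ k / k ! *
        (Real.exp (‖x‖ ^ 2 / 4) * D * (√(k ! : ℝ) * √(k ! : ℝ))) := by ring
    _ = C * D * (Real.exp (‖x‖ ^ 2 / 4) * Real.exp (4 * ‖y‖ * ‖x‖)) * (1 / 2) ^ k := by
        rw [hf, show 4 * (‖x‖ * ‖y‖) = 4 * ‖y‖ * ‖x‖ by ring]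
        field_simp
    _ = _ := by rw [← Real.exp_add]

theorem SlowGrowth.summable_kernelTerm {m : ℕ} (hm : 1 ≤ m) {μ : ℕ → ℂ} (hμ : SlowGrowth μ)
    (x y : E m) : Summable (kernelTerm m μ x y) := by
  obtain ⟨C, -, h⟩ := hμ.exists_kernelTerm_le hm y
  exact Summable.of_norm_bounded
    ((summable_geometric_of_lt_one (by norm_num) (by norm_num)).mul_left _) fun k => h x k

theorem aestronglyMeasurable_of_hasSum {m : ℕ} {F : ℕ → E m → ℂ} {f : E m → ℂ}
    (hF : ∀ n, AEStronglyMeasurable (F n)) (h : ∀ x, HasSum (fun n => F n x) (f x)) :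
    AEStronglyMeasurable f := by
  refine aestronglyMeasurable_of_tendsto_ae Filter.atTop
    (f := fun N x => ∑ i ∈ Finset.range N, F i x) (fun N => ?_)
    (Filter.Eventually.of_forall fun x => (h x).tendsto_sum_nat)
  exact Finset.aestronglyMeasurable_fun_sum _ fun i _ => hF i

theorem aestronglyMeasurable_kernelTerm {m : ℕ} (hm : 1 ≤ m) (μ : ℕ → ℂ) (y : E m) (k : ℕ) :
    AEStronglyMeasurable fun x : E m => kernelTerm m μ x y k := by
  have hl := neg_half_le_lam hm
  have hν : -1 / 2 ≤ k + lam m := by linarith [(k.cast_nonneg : (0 : ℝ) ≤ k)]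
  have hS : AEStronglyMeasurable fun x : E m =>
      ((∑' n : ℕ, besselCoeff (k + lam m) n * (‖x‖ * ‖y‖ / 2) ^ (2 * n) : ℝ) : ℂ) := by
    refine aestronglyMeasurable_of_hasSum (F := fun n x =>
      ((besselCoeff (k + lam m) n * (‖x‖ * ‖y‖ / 2) ^ (2 * n) : ℝ) : ℂ)) (fun n => ?_) fun x =>
      Complex.hasSum_ofReal.2 (summable_besselCoeff hν (by positivity)).hasSum
    exact Continuous.aestronglyMeasurable (by fun_prop)
  have hp : Continuous fun x : E m => evalAt x (zonalPoly m k y) :=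
    (temperate_eval m (zonalPoly m k y)).1.continuous
  simp only [kernelTerm_eq hm, Complex.ofReal_mul]
  exact (hp.aestronglyMeasurable.mul (aestronglyMeasurable_const.mul hS)).mul
    aestronglyMeasurable_const

/-- The majorant of `exists_kernelTerm_le` is geometric in k and integrable against the Gaussian, so
sum and integral commute; orthogonality leaves only the degree l. -/
theorem SlowGrowth.integral_kernel_mul {m : ℕ} (hm : 1 ≤ m) {μ : ℕ → ℂ} (hμ : SlowGrowth μ)
    {l : ℕ} {H : MvPolynomial (Fin m) ℂ} (hH : H ∈ sphericalHarmonics m l) (y : E m) (n : ℕ) :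
    Integrable (fun x => kernel m μ x y * polyGaussian m (sqNorm m ^ n * H) x) ∧
      (1 / ((2 * Real.pi) ^ ((m : ℝ) / 2) : ℝ) : ℂ) *
        ∫ x, kernel m μ x y * polyGaussian m (sqNorm m ^ n * H) x
      = μ l * polyGaussian m (radialMul ((m : ℝ) / 2 + l) n H) y := by
  obtain ⟨C, hC, h⟩ := hμ.exists_kernelTerm_le hm y
  set p := sqNorm m ^ n * H with hp
  set G : E m → ℝ := fun x => C * (Real.exp (‖x‖ ^ 2 / 4 + (4 * ‖y‖) * ‖x‖)
    * ‖polyGaussian m p x‖) with hG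
  have hGi : Integrable G := (integrable_exp_mul_polyGaussian _ _).const_mul C
  have hgeo := hasSum_geometric_of_lt_one (r := (1 / 2 : ℝ)) (by norm_num) (by norm_num)
  have hb (k : ℕ) (x : E m) :
      ‖kernelTerm m μ x y k * polyGaussian m p x‖ ≤ G x * (1 / 2) ^ k := by
    rw [norm_mul]
    refine (mul_le_mul_of_nonneg_right (h x k) (norm_nonneg _)).trans (le_of_eq ?_)
    simp only [hG]
    ring
  have hmeas (k : ℕ) :
      AEStronglyMeasurable fun x : E m => kernelTerm m μ x y k * polyGaussian m p x :=
    (aestronglyMeasurable_kernelTerm hm μ y k).mul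
      (polyGaussian m p).continuous.aestronglyMeasurable
  have hsum (x : E m) : HasSum (fun k => kernelTerm m μ x y k * polyGaussian m p x)
      (kernel m μ x y * polyGaussian m p x) :=
    (hμ.summable_kernelTerm hm x y).hasSum.mul_right _
  refine ⟨?_, ?_⟩
  · refine Integrable.mono' (hGi.mul_const ((1 - 1 / 2)⁻¹))
      (aestronglyMeasurable_of_hasSum hmeas hsum) (Filter.Eventually.of_forall fun x => ?_)
    rw [← (hsum x).tsum_eq]
    exact tsum_of_norm_bounded (hgeo.mul_left _) fun k => hb k x
  · have hmain := (hasSum_integral_of_dominated_convergence (fun k x => G x * (1 / 2) ^ k) hmeas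
      (fun k => Filter.Eventually.of_forall fun x => hb k x)
      (Filter.Eventually.of_forall fun x => hgeo.summable.mul_left _)
      (by
        simp only [tsum_mul_left]
        exact hGi.mul_const _)
      (Filter.Eventually.of_forall hsum)).mul_left
        (1 / ((2 * Real.pi) ^ ((m : ℝ) / 2) : ℝ) : ℂ)
    simp only [hp, integral_kernelTerm_mul hm μ hH y n] at hmain
    refine hmain.unique ?_
    have := hasSum_ite_eq l (μ l * polyGaussian m (radialMul ((m : ℝ) / 2 + l) n H) y)
    refine this.congr_fun fun k => ?_
    split_ifs with hk
    · rw [hk]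
    · rfl

/-! ## Entire functions of exponential type times the Gaussian -/

/-- Coefficients of a power series of exponential type `a`. -/
def FactorialBound (C a : ℝ) (d : ℕ → ℂ) : Prop := ∀ k, ‖d k‖ ≤ C * (a ^ k / k !)

/-- The sum of the power series with coefficients `d`. -/
def powSeries (d : ℕ → ℂ) (s : ℂ) : ℂ := ∑' k, d k * s ^ k

/-- The coefficients of the derivative of a power series. -/
def shiftCoeff (d : ℕ → ℂ) (k : ℕ) : ℂ := (k + 1) * d (k + 1)

namespace FactorialBound

variable {C a : ℝ} {d : ℕ → ℂ}

theorem shift (h : FactorialBound C a d) : FactorialBound (C * a) a (shiftCoeff d) := fun k => by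
  rw [shiftCoeff, norm_mul]
  have e : ‖(k : ℂ) + 1‖ = k + 1 := by
    rw [← Nat.cast_succ, Complex.norm_natCast, Nat.cast_succ]
  rw [e]
  refine (mul_le_mul_of_nonneg_left (h (k + 1)) (by positivity)).trans (le_of_eq ?_)
  rw [Nat.factorial_succ, pow_succ]
  push_cast
  field_simp

theorem norm_term_le (h : FactorialBound C a d) (s : ℂ) (k : ℕ) :
    ‖d k * s ^ k‖ ≤ C * ((a * ‖s‖) ^ k / k !) := by
  rw [norm_mul, norm_pow]
  refine (mul_le_mul_of_nonneg_right (h k) (by positivity)).trans (le_of_eq ?_)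
  rw [mul_pow]
  ring

theorem hasSum (h : FactorialBound C a d) (s : ℂ) :
    HasSum (fun k => d k * s ^ k) (powSeries d s) :=
  (Summable.of_norm_bounded ((Real.summable_pow_div_factorial (a * ‖s‖)).mul_left C)
    (h.norm_term_le s)).hasSum

theorem norm_powSeries_le (h : FactorialBound C a d) (s : ℂ) :
    ‖powSeries d s‖ ≤ C * Real.exp (a * ‖s‖) := by
  have he : HasSum (fun n : ℕ => (a * ‖s‖) ^ n / n !) (Real.exp (a * ‖s‖)) := by
    rw [Real.exp_eq_exp_ℝ]
    exact NormedSpace.expSeries_div_hasSum_exp _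
  exact tsum_of_norm_bounded (he.mul_left C) (h.norm_term_le s)

theorem hasDerivAt (h : FactorialBound C a d) (ha : 0 ≤ a) (s : ℂ) :
    HasDerivAt (powSeries d) (powSeries (shiftCoeff d) s) s := by
  have hC : 0 ≤ C := by
    have := h 0
    simp at this
    exact (norm_nonneg _).trans this
  set r : ℝ := ‖s‖ + 1 with hr
  have hr0 : 0 < r := by positivity
  set u : ℕ → ℝ := fun k => C * (k * a ^ k * r ^ (k - 1) / k !) with hu
  have hus : Summable u := by
    refine (summable_nat_add_iff 1).1 ?_
    refine ((Real.summable_pow_div_factorial (a * r)).mul_left (C * a)).congr fun k => ?_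
    simp only [hu, Nat.add_sub_cancel]
    rw [Nat.factorial_succ, mul_pow, pow_succ]
    push_cast
    field_simp
  have hmem : s ∈ Metric.ball (0 : ℂ) r := by simp [hr]
  have h1 := hasDerivAt_tsum_of_isPreconnected (𝕜 := ℂ) (g := fun k s => d k * s ^ k)
    (g' := fun k s => d k * (k * s ^ (k - 1))) hus Metric.isOpen_ball
    (convex_ball (0 : ℂ) r).isPreconnected
    (fun k s _ => (hasDerivAt_pow k s).const_mul (d k)) (fun k t ht => ?_) hmem
    (h.hasSum s).summable hmem
  · have h2 : ∑' k : ℕ, d k * (k * s ^ (k - 1)) = powSeries (shiftCoeff d) s := by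
      refine HasSum.tsum_eq ((hasSum_nat_add_iff' 1).1 ?_)
      simp only [Finset.range_one, Finset.sum_singleton, Nat.cast_zero, zero_mul, mul_zero,
        sub_zero]
      refine (h.shift.hasSum s).congr_fun fun k => ?_
      simp only [shiftCoeff, Nat.add_sub_cancel]
      push_cast
      ring
    rw [h2] at h1
    exact h1
  · have ht' : ‖t‖ ≤ r := by simpa using (Metric.mem_ball.1 ht).le
    rw [norm_mul, norm_mul, norm_pow, Complex.norm_natCast]
    calc ‖d k‖ * (k * ‖t‖ ^ (k - 1)) ≤ (C * (a ^ k / k !)) * (k * r ^ (k - 1)) := by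
          gcongr
          exact h k
      _ = u k := by
          simp only [hu]
          ring

theorem contDiff (h : FactorialBound C a d) (ha : 0 ≤ a) : ContDiff ℝ ∞ (powSeries d) := by
  have : Differentiable ℂ (powSeries d) := fun s => (h.hasDerivAt ha s).differentiableAt
  exact (this.contDiff (n := ∞)).restrict_scalars ℝ

theorem contDiff_comp {m : ℕ} (h : FactorialBound C a d) (ha : 0 ≤ a) (L : E m →L[ℝ] ℂ) :
    ContDiff ℝ ∞ fun x => powSeries d (L x) :=
  (h.contDiff ha).comp L.contDiff

theorem hasFDerivAt_comp {m : ℕ} (h : FactorialBound C a d) (ha : 0 ≤ a) (L : E m →L[ℝ] ℂ)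
    (x : E m) :
    HasFDerivAt (fun x => powSeries d (L x)) (powSeries (shiftCoeff d) (L x) • L) x := by
  have := (h.hasDerivAt ha (L x)).complexToReal_fderiv.comp x L.hasFDerivAt
  refine this.congr_fderiv ?_
  ext v
  simp

/-- Each derivative shifts the coefficients, at the cost of a factor a in the constant, and
contributes one factor `L`; the induction therefore runs over all `C` and `d`. -/
theorem norm_iteratedFDeriv_comp_le {m : ℕ} (h : FactorialBound C a d) (ha : 0 ≤ a)
    (L : E m →L[ℝ] ℂ) (n : ℕ) (x : E m) :
    ‖iteratedFDeriv ℝ n (fun x => powSeries d (L x)) x‖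
      ≤ C * (a * ‖L‖) ^ n * Real.exp (a * ‖L‖ * ‖x‖) := by
  have hC : 0 ≤ C := by
    have := h 0
    simp at this
    exact (norm_nonneg _).trans this
  induction n generalizing C d with
  | zero =>
    rw [norm_iteratedFDeriv_zero, pow_zero, mul_one, mul_assoc a]
    refine (h.norm_powSeries_le _).trans ?_
    gcongr
    exact L.le_opNorm x
  | succ n ih =>
    set M : ℂ →L[ℝ] (E m →L[ℝ] ℂ) := (ContinuousLinearMap.lsmul ℝ ℂ).flip L with hM
    have e : fderiv ℝ (fun x => powSeries d (L x))
        = M ∘ fun x => powSeries (shiftCoeff d) (L x) := by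
      funext x
      rw [(h.hasFDerivAt_comp ha L x).fderiv]
      rfl
    have hMn : ‖M‖ ≤ ‖L‖ := by
      refine M.opNorm_le_bound (norm_nonneg _) fun z => ?_
      refine (ContinuousLinearMap.opNorm_le_bound _ (by positivity) fun v => ?_)
      change ‖z • L v‖ ≤ _
      rw [norm_smul, mul_comm ‖L‖, mul_assoc]
      gcongr
      exact L.le_opNorm v
    rw [← norm_iteratedFDeriv_fderiv, e]
    refine (M.norm_iteratedFDeriv_comp_left ((h.shift.contDiff_comp ha L).contDiffAt)
      (mod_cast le_top)).trans ?_
    refine (mul_le_mul hMn (ih h.shift (by positivity)) (norm_nonneg _) (norm_nonneg _)).trans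
      (le_of_eq ?_)
    ring

end FactorialBound

theorem gaussian_exp_decay (m k n : ℕ) (b : ℝ) : ∃ C : ℝ, ∀ x : E m,
    ‖x‖ ^ k * Real.exp (b * ‖x‖)
      * ‖iteratedFDeriv ℝ n (fun x : E m => Real.exp (-‖x‖ ^ 2 / 2)) x‖ ≤ C := by
  have hq : (fun x : E m => -‖x‖ ^ 2 / 2).HasTemperateGrowth := by
    have h := (Function.HasTemperateGrowth.const (E := E m) (-1 / 2 : ℝ)).mul
      (Function.hasTemperateGrowth_norm_sq (E m))
    have e : (fun x : E m => -‖x‖ ^ 2 / 2) = (fun _ => (-1 / 2 : ℝ)) * fun x : E m => ‖x‖ ^ 2 := by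
      funext x
      simp only [Pi.mul_apply]
      ring
    rw [e]
    exact h
  obtain ⟨N, C, hC, hD⟩ := hq.norm_iteratedFDeriv_le_uniform n
  have hB (t : ℝ) (ht : 0 ≤ t) : t ^ k * Real.exp (b * t) * (1 + t) ^ (N * n)
      * Real.exp (-t ^ 2 / 2) ≤ ((k + N * n)! : ℝ) * Real.exp (1 + (1 + b) ^ 2 / 2) := by
    have h1 : t ^ k * (1 + t) ^ (N * n) ≤ (1 + t) ^ (k + N * n) := by
      rw [pow_add]
      gcongr
      linarith
    have h2 : (1 + t) ^ (k + N * n) ≤ ((k + N * n)! : ℝ) * Real.exp (1 + t) := by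
      have := Real.pow_div_factorial_le_exp (1 + t) (by linarith) (k + N * n)
      rw [div_le_iff₀ (by positivity)] at this
      linarith
    calc t ^ k * Real.exp (b * t) * (1 + t) ^ (N * n) * Real.exp (-t ^ 2 / 2)
        = t ^ k * (1 + t) ^ (N * n) * (Real.exp (b * t) * Real.exp (-t ^ 2 / 2)) := by ring
      _ ≤ ((k + N * n)! : ℝ) * Real.exp (1 + t) * (Real.exp (b * t) * Real.exp (-t ^ 2 / 2)) :=
          mul_le_mul_of_nonneg_right (h1.trans h2) (by positivity)
      _ = ((k + N * n)! : ℝ) * Real.exp (1 + t + (b * t + -t ^ 2 / 2)) := by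
          rw [Real.exp_add (1 + t), Real.exp_add (b * t)]
          ring
      _ ≤ _ := by
          refine mul_le_mul_of_nonneg_left (Real.exp_le_exp.2 ?_) (by positivity)
          nlinarith [sq_nonneg (t - (1 + b))]
  refine ⟨n ! * (C + 1) ^ n * (((k + N * n)! : ℝ) * Real.exp (1 + (1 + b) ^ 2 / 2)), fun x => ?_⟩
  have key := norm_iteratedFDeriv_comp_le (n := n) (N := ∞) (g := Real.exp)
    (f := fun x : E m => -‖x‖ ^ 2 / 2) Real.contDiff_exp hq.1 (mod_cast le_top) x
    (C := Real.exp (-‖x‖ ^ 2 / 2)) (D := (C + 1) * (1 + ‖x‖) ^ N) (by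
      intro i _
      rw [norm_iteratedFDeriv_eq_norm_iteratedDeriv, iteratedDeriv_eq_iterate,
        Real.iter_deriv_exp, Real.norm_eq_abs, abs_of_pos (Real.exp_pos _)]) (by
      intro i hi hin
      refine (hD i hin x).trans ?_
      have h1 : C * (1 + ‖x‖) ^ N ≤ (C + 1) * (1 + ‖x‖) ^ N := by
        gcongr
        linarith
      refine h1.trans (le_self_pow₀ ?_ (by omega))
      have : (1 : ℝ) ≤ (1 + ‖x‖) ^ N := one_le_pow₀ (by linarith [norm_nonneg x])
      nlinarith)
  calc ‖x‖ ^ k * Real.exp (b * ‖x‖)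
        * ‖iteratedFDeriv ℝ n (fun x : E m => Real.exp (-‖x‖ ^ 2 / 2)) x‖
      ≤ ‖x‖ ^ k * Real.exp (b * ‖x‖)
        * (n ! * Real.exp (-‖x‖ ^ 2 / 2) * ((C + 1) * (1 + ‖x‖) ^ N) ^ n) := by
        gcongr
        exact key
    _ = n ! * (C + 1) ^ n
        * (‖x‖ ^ k * Real.exp (b * ‖x‖) * (1 + ‖x‖) ^ (N * n) * Real.exp (-‖x‖ ^ 2 / 2)) := by
        rw [mul_pow, ← pow_mul]
        ring
    _ ≤ _ := by
        exact mul_le_mul_of_nonneg_left (hB _ (norm_nonneg x)) (by positivity)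

/-- The Schwartz function `G(L x) exp(-|x|²/2)`, where `G` is an entire function of exponential
type with Taylor coefficients `d` and `L` is linear. -/
def expTypeGaussian {m : ℕ} {C a : ℝ} {d : ℕ → ℂ} (h : FactorialBound C a d) (ha : 0 ≤ a)
    (L : E m →L[ℝ] ℂ) : 𝓢(E m, ℂ) where
  toFun x := Real.exp (-‖x‖ ^ 2 / 2) • powSeries d (L x)
  smooth' := (gaussian_contDiff m).smul (h.contDiff_comp ha L)
  decay' k n := by
    have hC : 0 ≤ C := by
      have := h 0
      simp at this
      exact (norm_nonneg _).trans this
    choose B hB using fun i : ℕ => gaussian_exp_decay m k i (a * ‖L‖)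
    refine ⟨∑ i ∈ Finset.range (n + 1), (n.choose i : ℝ) * B i * (C * (a * ‖L‖) ^ (n - i)),
      fun x => ?_⟩
    have h1 := norm_iteratedFDeriv_smul_le (𝕜 := ℝ) (gaussian_contDiff m) (h.contDiff_comp ha L) x
      (n := n) (mod_cast le_top)
    refine (mul_le_mul_of_nonneg_left h1 (by positivity)).trans ?_
    rw [Finset.mul_sum]
    refine Finset.sum_le_sum fun i _ => ?_
    have h2 := h.norm_iteratedFDeriv_comp_le ha L (n - i) x
    calc ‖x‖ ^ k * ((n.choose i : ℝ)
          * ‖iteratedFDeriv ℝ i (fun x : E m => Real.exp (-‖x‖ ^ 2 / 2)) x‖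
          * ‖iteratedFDeriv ℝ (n - i) (fun x => powSeries d (L x)) x‖)
        ≤ ‖x‖ ^ k * ((n.choose i : ℝ)
          * ‖iteratedFDeriv ℝ i (fun x : E m => Real.exp (-‖x‖ ^ 2 / 2)) x‖
          * (C * (a * ‖L‖) ^ (n - i) * Real.exp (a * ‖L‖ * ‖x‖))) := by
          gcongr
      _ = (n.choose i : ℝ) * (‖x‖ ^ k * Real.exp (a * ‖L‖ * ‖x‖)
          * ‖iteratedFDeriv ℝ i (fun x : E m => Real.exp (-‖x‖ ^ 2 / 2)) x‖)
          * (C * (a * ‖L‖) ^ (n - i)) := by ring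
      _ ≤ _ := by
          gcongr
          exact hB i x

theorem expTypeGaussian_apply {m : ℕ} {C a : ℝ} {d : ℕ → ℂ} (h : FactorialBound C a d)
    (ha : 0 ≤ a) (L : E m →L[ℝ] ℂ) (x : E m) :
    expTypeGaussian h ha L x = powSeries d (L x) * (Real.exp (-‖x‖ ^ 2 / 2) : ℂ) := by
  change Real.exp (-‖x‖ ^ 2 / 2) • powSeries d (L x) = _
  rw [Complex.real_smul, mul_comm]

/-- The linear form with coefficients `y` as a real linear map. -/
def linCLM {m : ℕ} (y : Fin m → ℂ) : E m →L[ℝ] ℂ := ∑ i, y i • coordCLM i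

theorem linCLM_apply {m : ℕ} (y : Fin m → ℂ) (x : E m) : linCLM y x = evalAt x (linForm y) := by
  simp [linCLM, linForm, coordCLM_apply]

theorem linCLM_basis {m : ℕ} (y : Fin m → ℂ) (i : Fin m) :
    linCLM y (EuclideanSpace.basisFun (Fin m) ℝ i) = y i := by
  classical
  simp [linCLM, coordCLM_apply, apply_ite]

theorem sum_smul_coordCLM_basis {m : ℕ} (x : E m) (i : Fin m) :
    (∑ j, (x j : ℂ) • coordCLM j : E m →L[ℝ] ℂ) (EuclideanSpace.basisFun (Fin m) ℝ i)
      = (x i : ℂ) :=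
  linCLM_basis (fun j => (x j : ℂ)) i

theorem lineDeriv_expTypeGaussian {m : ℕ} {C a : ℝ} {d : ℕ → ℂ} (h : FactorialBound C a d)
    (ha : 0 ≤ a) (y : Fin m → ℂ) (i : Fin m) (x : E m) :
    ∂_{EuclideanSpace.basisFun (Fin m) ℝ i} (expTypeGaussian h ha (linCLM y)) x
      = (y i * powSeries (shiftCoeff d) (linCLM y x) - (x i : ℂ) * powSeries d (linCLM y x))
        * (Real.exp (-‖x‖ ^ 2 / 2) : ℂ) := by
  rw [SchwartzMap.lineDerivOp_apply_eq_fderiv]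
  have h1 := (h.hasFDerivAt_comp ha (linCLM y) x).mul (hasFDerivAt_gaussian x)
  have e : (expTypeGaussian h ha (linCLM y) : E m → ℂ)
      = (fun x => powSeries d (linCLM y x)) * fun x => (Real.exp (-‖x‖ ^ 2 / 2) : ℂ) :=
    funext fun x => expTypeGaussian_apply h ha _ x
  rw [e, h1.fderiv]
  simp only [add_apply, smul_apply, sum_smul_coordCLM_basis, linCLM_basis, smul_eq_mul]
  ring

theorem lineDeriv_lineDeriv_expTypeGaussian {m : ℕ} {C a : ℝ} {d : ℕ → ℂ}
    (h : FactorialBound C a d) (ha : 0 ≤ a) (y : Fin m → ℂ) (i : Fin m) (x : E m) :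
    ∂_{EuclideanSpace.basisFun (Fin m) ℝ i} (∂_{EuclideanSpace.basisFun (Fin m) ℝ i}
      (expTypeGaussian h ha (linCLM y))) x
      = (y i ^ 2 * powSeries (shiftCoeff (shiftCoeff d)) (linCLM y x)
          - 2 * (y i * (x i : ℂ)) * powSeries (shiftCoeff d) (linCLM y x)
          + ((x i : ℂ) ^ 2 - 1) * powSeries d (linCLM y x)) * (Real.exp (-‖x‖ ^ 2 / 2) : ℂ) := by
  rw [SchwartzMap.lineDerivOp_apply_eq_fderiv]
  have h1 := ((h.shift.hasFDerivAt_comp ha (linCLM y) x).const_mul (y i)).sub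
    ((coordCLM i).hasFDerivAt.mul (h.hasFDerivAt_comp ha (linCLM y) x))
  have h2 := h1.mul (hasFDerivAt_gaussian x)
  have e : ((∂_{EuclideanSpace.basisFun (Fin m) ℝ i} (expTypeGaussian h ha (linCLM y)) :
      𝓢(E m, ℂ)) : E m → ℂ)
      = ((fun x => y i * powSeries (shiftCoeff d) (linCLM y x))
        - (coordCLM i : E m → ℂ) * fun x => powSeries d (linCLM y x))
        * fun x => (Real.exp (-‖x‖ ^ 2 / 2) : ℂ) :=
    funext fun x => lineDeriv_expTypeGaussian h ha y i x
  have hc : coordCLM i (EuclideanSpace.basisFun (Fin m) ℝ i) = 1 := by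
    simp [coordCLM_apply]
  rw [e, h2.fderiv]
  simp only [sub_apply, add_apply, smul_apply, Pi.sub_apply, Pi.mul_apply, linCLM_basis, hc,
    sum_smul_coordCLM_basis, smul_eq_mul, coordCLM_apply]
  ring

/-- Twice the Hamiltonian of the harmonic oscillator, `|x|² - Δ`. -/
def oscillator {m : ℕ} (f : 𝓢(E m, ℂ)) : 𝓢(E m, ℂ) := normSqMul m f - Δ f

/-- For isotropic y the second-derivative term of G drops out and |x|² cancels, leaving mG + 2sG'.
The oscillator is thus diagonal on Taylor coefficients, which makes it explicitly invertible off one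
degree. -/
theorem oscillator_expTypeGaussian_apply {m : ℕ} {C a : ℝ} {d : ℕ → ℂ}
    (h : FactorialBound C a d) (ha : 0 ≤ a) {y : Fin m → ℂ} (hy : ∑ i, y i ^ 2 = 0) (x : E m) :
    oscillator (expTypeGaussian h ha (linCLM y)) x
      = powSeries (fun k => (m + 2 * k) * d k) (linCLM y x) * (Real.exp (-‖x‖ ^ 2 / 2) : ℂ) := by
  have hs := h.hasSum (linCLM y x)
  have hs' : HasSum (fun k : ℕ => (k : ℂ) * d k * linCLM y x ^ k)
      (linCLM y x * powSeries (shiftCoeff d) (linCLM y x)) := by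
    refine (hasSum_nat_add_iff' 1).1 ?_
    simp only [Finset.range_one, Finset.sum_singleton, Nat.cast_zero, zero_mul, sub_zero]
    refine ((h.shift.hasSum (linCLM y x)).mul_left (linCLM y x)).congr_fun fun k => ?_
    simp only [shiftCoeff]
    push_cast
    ring
  have hG : powSeries (fun k => (m + 2 * k) * d k) (linCLM y x)
      = m * powSeries d (linCLM y x)
        + 2 * (linCLM y x * powSeries (shiftCoeff d) (linCLM y x)) := by
    refine HasSum.tsum_eq (((hs.mul_left (m : ℂ)).add (hs'.mul_left 2)).congr_fun fun k => ?_)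
    ring
  have hL : ∑ i, y i * (x i : ℂ) = linCLM y x := by
    simp [linCLM, coordCLM_apply]
  have hn := sum_coord_sq x
  rw [hG, oscillator, sub_apply, normSqMul_apply, expTypeGaussian_apply,
    SchwartzMap.laplacian_eq_sum (EuclideanSpace.basisFun (Fin m) ℝ), sum_apply]
  simp only [lineDeriv_lineDeriv_expTypeGaussian]
  rw [← Finset.sum_mul, Finset.sum_add_distrib, Finset.sum_sub_distrib, ← Finset.sum_mul,
    ← Finset.sum_mul, ← Finset.sum_mul, ← Finset.mul_sum, hy, hL, Finset.sum_sub_distrib, hn]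
  simp only [Finset.sum_const, Finset.card_univ, Fintype.card_fin, nsmul_eq_mul, mul_one]
  ring

theorem oscillator_polyGaussian {m k : ℕ} {H : MvPolynomial (Fin m) ℂ}
    (hH : H ∈ sphericalHarmonics m k) :
    oscillator (polyGaussian m H) = ((m : ℂ) + 2 * k) • polyGaussian m H := by
  have h := laplacian_polyGaussian_sqNorm_pow hH 0
  simp only [pow_zero, one_mul, Nat.cast_zero, zero_add, pow_one, mul_zero, zero_mul,
    zero_smul] at h
  rw [oscillator, normSqMul_polyGaussian, h]
  module

theorem HelmholtzRelations.map_oscillator {m : ℕ} {T : 𝓢(E m, ℂ) →ₗ[ℂ] 𝓢(E m, ℂ)}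
    (hT : HelmholtzRelations T) (f : 𝓢(E m, ℂ)) : T (oscillator f) = oscillator (T f) := by
  rw [oscillator, map_sub, hT.1, hT.2, oscillator]
  abel

theorem integrable_mul {m : ℕ} (f g : 𝓢(E m, ℂ)) : Integrable fun x => f x * g x :=
  (g.integrable (μ := volume)).bdd_mul f.continuous.aestronglyMeasurable
    (Filter.Eventually.of_forall (SchwartzMap.norm_le_seminorm ℝ f))

theorem integral_oscillator_mul {m : ℕ} (f g : 𝓢(E m, ℂ)) :
    ∫ x, oscillator f x * g x = ∫ x, f x * oscillator g x := by
  have h := SchwartzMap.integral_mul_laplacian_right_eq_left (μ := volume) f g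
  simp only [oscillator, sub_apply, sub_mul, mul_sub]
  rw [integral_sub (integrable_mul _ _) (integrable_mul _ _),
    integral_sub (integrable_mul _ _) (integrable_mul _ _), h]
  congr 1
  refine integral_congr_ae (Filter.Eventually.of_forall fun x => ?_)
  simp only [normSqMul_apply]
  ring

/-! ## Growth of the eigenvalues -/

theorem linForm_pow_mem {m : ℕ} {y : Fin m → ℂ} (hy : ∑ i, y i ^ 2 = 0) (k : ℕ) :
    linForm y ^ k ∈ sphericalHarmonics m k := by
  refine mem_sphericalHarmonics.2 ⟨by simpa using (isHomogeneous_linForm y).pow k, ?_⟩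
  rw [polyLaplacian_linForm_pow, hy, mul_zero, map_zero, zero_mul]

/-- The dilation x ↦ √2 x turns the product e^{-|x|²} of the two Gaussians into the standard one,
where the reproducing property applies. -/
theorem integral_linForm_pow {m : ℕ} {y z : Fin m → ℂ} (hz : ∑ i, z i ^ 2 = 0) (N : ℕ) :
    ∫ x, polyGaussian m (linForm y ^ N) x * polyGaussian m (linForm z ^ N) x
      = (((2 * Real.pi) ^ ((m : ℝ) / 2) / √2 ^ m : ℝ) : ℂ)
        * (N ! * ((∑ i, z i * y i) / 2) ^ N) := by
  have hI := isGaussianFunctional_gaussianIntegral m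
  have h1 := hI.linForm_pow_mul y (linForm_pow_mem hz N)
  have h2 : eval y (linForm z ^ N) = (∑ i, z i * y i) ^ N := by
    simp [linForm]
  rw [h2, gaussianIntegral_apply] at h1
  set c : ℝ := (2 * Real.pi) ^ ((m : ℝ) / 2) with hc
  have hc0 : (c : ℂ) ≠ 0 := by
    have : 0 < c := by positivity
    exact_mod_cast this.ne'
  have h3 : ∫ x, polyGaussian m (linForm y ^ N * linForm z ^ N) x
      = c * (N ! * (∑ i, z i * y i) ^ N) := by
    rw [← h1]
    field_simp
  have h4 := Measure.integral_comp_smul_of_nonneg (volume : Measure (E m))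
    (fun x => polyGaussian m (linForm y ^ N * linForm z ^ N) x) (√2) (hR := Real.sqrt_nonneg 2)
  have h5 (x : E m) : polyGaussian m (linForm y ^ N * linForm z ^ N) (√2 • x)
      = 2 ^ N * (polyGaussian m (linForm y ^ N) x * polyGaussian m (linForm z ^ N) x) := by
    have hs : ((√2 : ℝ) : ℂ) ^ N * ((√2 : ℝ) : ℂ) ^ N = 2 ^ N := by
      rw [← mul_pow, ← Complex.ofReal_mul, Real.mul_self_sqrt (by norm_num)]
      norm_num
    have he : Real.exp (-‖√2 • x‖ ^ 2 / 2)
        = Real.exp (-‖x‖ ^ 2 / 2) * Real.exp (-‖x‖ ^ 2 / 2) := by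
      rw [← Real.exp_add, norm_smul, mul_pow, Real.norm_of_nonneg (Real.sqrt_nonneg 2),
        Real.sq_sqrt (by norm_num)]
      congr 1
      ring
    simp only [polyGaussian_apply, map_mul, map_pow, ← linCLM_apply, map_smul, he]
    rw [Complex.real_smul, Complex.real_smul, mul_pow, mul_pow, ← hs]
    push_cast
    ring
  simp only [h5] at h4
  rw [integral_const_mul, finrank_euclideanSpace_fin, h3, Complex.real_smul] at h4
  have h6 : (2 : ℂ) ^ N ≠ 0 := pow_ne_zero _ two_ne_zero
  refine mul_left_cancel₀ h6 (h4.trans ?_)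
  rw [div_pow]
  push_cast
  field_simp

theorem norm_polyGaussian_linForm_pow_le {m : ℕ} (z : Fin m → ℂ) (N : ℕ) (x : E m) :
    ‖polyGaussian m (linForm z ^ N) x‖ ≤ ‖linCLM z‖ ^ N * √(N ! : ℝ) := by
  have h := pow_le_sqrt_factorial_mul_exp (norm_nonneg x) N
  have h1 := (linCLM z).le_opNorm x
  rw [polyGaussian_apply, map_pow, ← linCLM_apply, norm_mul, norm_pow, Complex.norm_real,
    Real.norm_of_nonneg (Real.exp_pos _).le]
  calc ‖linCLM z x‖ ^ N * Real.exp (-‖x‖ ^ 2 / 2)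
      ≤ (‖linCLM z‖ * ‖x‖) ^ N * Real.exp (-‖x‖ ^ 2 / 2) := by gcongr
    _ ≤ ‖linCLM z‖ ^ N * (√(N ! : ℝ) * Real.exp (‖x‖ ^ 2 / 2)) * Real.exp (-‖x‖ ^ 2 / 2) := by
        rw [mul_pow]
        gcongr
    _ = ‖linCLM z‖ ^ N * √(N ! : ℝ) * Real.exp (‖x‖ ^ 2 / 2 + -‖x‖ ^ 2 / 2) := by
        rw [Real.exp_add]
        ring
    _ = _ := by
        rw [neg_div, add_neg_cancel, Real.exp_zero, mul_one]

/-- The pairing of `T f` with a harmonic polynomial times the Gaussian only depends on the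
component of `f` in the corresponding eigenspace of the harmonic oscillator. -/
theorem integral_map_expTypeGaussian {m : ℕ} {T : 𝓢(E m, ℂ) →ₗ[ℂ] 𝓢(E m, ℂ)}
    (hT : HelmholtzRelations T) {y : Fin m → ℂ} (hy : ∑ i, y i ^ 2 = 0) {N : ℕ} {c : ℂ}
    (hc : T (polyGaussian m (linForm y ^ N)) = c • polyGaussian m (linForm y ^ N))
    {H : MvPolynomial (Fin m) ℂ} (hH : H ∈ sphericalHarmonics m N) {C a : ℝ} {d : ℕ → ℂ}
    (h : FactorialBound C a d) (ha : 0 ≤ a) :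
    ∫ x, T (expTypeGaussian h ha (linCLM y)) x * polyGaussian m H x
      = d N * c * ∫ x, polyGaussian m (linForm y ^ N) x * polyGaussian m H x := by
  -- The coefficients of `d` away from N, divided by the eigenvalue differences (m + 2k) - (m + 2N).
  -- These have modulus at least 1, so `g` obeys the same bound and again defines a Schwartz
  -- function.
  set g : ℕ → ℂ := fun k => if k = N then 0 else d k / (2 * (k - N)) with hg
  have hgb : FactorialBound C a g := fun k => by
    refine le_trans ?_ (h k)
    simp only [hg]
    split_ifs with hk
    · simp
    · rw [norm_div]
      refine div_le_self (norm_nonneg _) ?_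
      have e : (2 * ((k : ℂ) - N)) = ((2 * ((k : ℤ) - N) : ℤ) : ℂ) := by push_cast; ring
      rw [e, Complex.norm_intCast]
      have : (1 : ℤ) ≤ |2 * ((k : ℤ) - N)| := Int.one_le_abs (by omega)
      exact_mod_cast this
  set f := expTypeGaussian h ha (linCLM y) with hf
  set G := expTypeGaussian hgb ha (linCLM y) with hG
  -- A finite decomposition of f, to which T applies by linearity alone; an infinite expansion in
  -- eigenfunctions would require continuity.
  have key : f = d N • polyGaussian m (linForm y ^ N)
      + (oscillator G - ((m : ℂ) + 2 * N) • G) := by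
    ext x
    have h1 := h.hasSum (linCLM y x)
    have h2 := hgb.hasSum (linCLM y x)
    have h3 : HasSum (fun k => (if k = N then d N * linCLM y x ^ N else 0))
        (d N * linCLM y x ^ N) := hasSum_ite_eq N _
    have h4 : powSeries (fun k => (m + 2 * k) * g k) (linCLM y x)
        = powSeries d (linCLM y x) - d N * linCLM y x ^ N
          + (m + 2 * N) * powSeries g (linCLM y x) := by
      refine HasSum.tsum_eq
        (((h1.sub h3).add (h2.mul_left ((m : ℂ) + 2 * N))).congr_fun fun k => ?_)
      simp only [hg]
      split_ifs with hk
      · subst hk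
        ring
      · have : (k : ℂ) - N ≠ 0 := sub_ne_zero.2 (by exact_mod_cast hk)
        field_simp
        ring
    rw [add_apply, sub_apply, smul_apply, smul_apply, oscillator_expTypeGaussian_apply hgb ha hy,
      expTypeGaussian_apply, expTypeGaussian_apply, polyGaussian_apply, h4, map_pow, ← linCLM_apply]
    simp only [smul_eq_mul]
    ring
  -- The oscillator is symmetric for the bilinear pairing, and H e^{-|x|²/2} is an eigenfunction
  -- with eigenvalue m + 2N.
  have h5 : ∫ x, (oscillator (T G) x - ((m : ℂ) + 2 * N) * T G x) * polyGaussian m H x = 0 := by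
    have e := integral_oscillator_mul (T G) (polyGaussian m H)
    rw [oscillator_polyGaussian hH] at e
    simp only [sub_mul]
    rw [integral_sub (integrable_mul _ _)
      (by simpa only [mul_assoc] using (integrable_mul (T G) (polyGaussian m H)).const_mul _), e,
      ← integral_sub (integrable_mul _ _)
      (by simpa only [mul_assoc] using (integrable_mul (T G) (polyGaussian m H)).const_mul _)]
    refine integral_eq_zero_of_ae (Filter.Eventually.of_forall fun x => ?_)
    simp only [smul_apply, smul_eq_mul, Pi.zero_apply]
    ring
  have h6 (x : E m) : T f x * polyGaussian m H x
      = d N * c * (polyGaussian m (linForm y ^ N) x * polyGaussian m H x)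
        + (oscillator (T G) x - ((m : ℂ) + 2 * N) * T G x) * polyGaussian m H x := by
    rw [key, map_add, map_sub, map_smul, map_smul, hc, hT.map_oscillator, add_apply, sub_apply,
      smul_apply, smul_apply, smul_apply]
    simp only [smul_eq_mul]
    ring
  have h7 : Integrable fun x =>
      (oscillator (T G) x - ((m : ℂ) + 2 * N) * T G x) * polyGaussian m H x :=
    integrable_mul (oscillator (T G) - ((m : ℂ) + 2 * N) • T G) (polyGaussian m H)
  simp only [h6]
  rw [integral_add ((integrable_mul _ _).const_mul _) h7, h5, add_zero, integral_const_mul]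

/-- The pairing equals μ_N a^N K, while it is at most ‖T f‖_{L¹} times the supremum of |⟨x,z⟩^N
e^{-|x|²/2}|, which is O(Λ^N √N!). As a is arbitrary, it can outweigh Λ. -/
theorem slowGrowth_of_helmholtz {m : ℕ} (hm : 2 ≤ m) {T : 𝓢(E m, ℂ) →ₗ[ℂ] 𝓢(E m, ℂ)}
    (hT : HelmholtzRelations T) {μ : ℕ → ℂ}
    (hμ : ∀ k, ∀ H ∈ sphericalHarmonics m k, T (polyGaussian m H) = μ k • polyGaussian m H) :
    SlowGrowth μ := by
  set i0 : Fin m := ⟨0, by omega⟩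
  set i1 : Fin m := ⟨1, by omega⟩
  have hne : i0 ≠ i1 := by simp [i0, i1]
  -- The isotropic vectors e_0 ± i e_1 need two dimensions. They are complex conjugate, so that ∑
  -- z_i y_i = 2 makes the pairing of the N-th powers nonzero.
  set y : Fin m → ℂ := Pi.single i0 1 + Pi.single i1 Complex.I with hy
  set z : Fin m → ℂ := Pi.single i0 1 - Pi.single i1 Complex.I with hz
  have hsum (w : Fin m → ℂ) (hw : ∀ i, i ≠ i0 → i ≠ i1 → w i = 0) : ∑ i, w i = w i0 + w i1 := by
    rw [← Finset.sum_pair hne]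
    refine (Finset.sum_subset (Finset.subset_univ _) fun i _ hi => ?_).symm
    simp only [Finset.mem_insert, Finset.mem_singleton, not_or] at hi
    exact hw i hi.1 hi.2
  have hy0 : ∑ i, y i ^ 2 = 0 := by
    rw [hsum _ fun i h0 h1 => by simp [hy, h0, h1]]
    simp [hy, hne, hne.symm]
  have hz0 : ∑ i, z i ^ 2 = 0 := by
    rw [hsum _ fun i h0 h1 => by simp [hz, h0, h1]]
    simp [hz, hne, hne.symm]
  have hzy : ∑ i, z i * y i = 2 := by
    rw [hsum _ fun i h0 h1 => by simp [hz, h0, h1]]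
    simp [hz, hy, hne, hne.symm]
    norm_num
  set Λ : ℝ := ‖linCLM z‖ with hΛ
  set K : ℝ := (2 * Real.pi) ^ ((m : ℝ) / 2) / √2 ^ m with hK
  have hK0 : 0 < K := by positivity
  intro b hb
  -- The factor Λ + 1 dominates Λ and is positive, so its N-th power can be cancelled at the end.
  set a : ℝ := b * (Λ + 1) with ha
  have hΛ0 : 0 ≤ Λ := norm_nonneg _
  have ha0 : 0 ≤ a := by positivity
  have hd : FactorialBound 1 a fun k => ((a ^ k / k ! : ℝ) : ℂ) := fun k => by
    rw [Complex.norm_real, one_mul, Real.norm_of_nonneg (by positivity)]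
  set f := T (expTypeGaussian hd ha0 (linCLM y)) with hf
  set M : ℝ := ∫ x, ‖f x‖ with hM
  have hM0 : 0 ≤ M := integral_nonneg fun x => norm_nonneg _
  refine ⟨M / K, fun N => ?_⟩
  have h1 := integral_map_expTypeGaussian hT hy0 (hμ N _ (linForm_pow_mem hy0 N))
    (linForm_pow_mem hz0 N) hd ha0
  rw [integral_linForm_pow hz0, hzy, div_self two_ne_zero, one_pow, mul_one] at h1
  have h2 : ‖∫ x, f x * polyGaussian m (linForm z ^ N) x‖ ≤ M * (Λ ^ N * √(N ! : ℝ)) := by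
    rw [hM, ← integral_mul_const]
    refine norm_integral_le_of_norm_le (f.integrable.norm.mul_const _)
      (Filter.Eventually.of_forall fun x => ?_)
    rw [norm_mul]
    exact mul_le_mul_of_nonneg_left (norm_polyGaussian_linForm_pow_le z N x) (norm_nonneg _)
  rw [h1, norm_mul, norm_mul, norm_mul, Complex.norm_real, Complex.norm_real, Complex.norm_natCast,
    Real.norm_of_nonneg (by positivity : 0 ≤ a ^ N / (N ! : ℝ)), ← hK, Real.norm_of_nonneg hK0.le]
    at h2
  have hN : (N ! : ℝ) ≠ 0 := by positivity
  have h3 : ‖μ N‖ * a ^ N * K ≤ M * (Λ ^ N * √(N ! : ℝ)) := by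
    refine le_trans (le_of_eq ?_) h2
    field_simp
  have h4 : Λ ^ N ≤ (Λ + 1) ^ N := by
    gcongr
    linarith
  have h5 : ‖μ N‖ * b ^ N * K * (Λ + 1) ^ N ≤ M * √(N ! : ℝ) * (Λ + 1) ^ N := by
    calc ‖μ N‖ * b ^ N * K * (Λ + 1) ^ N = ‖μ N‖ * a ^ N * K := by
          rw [ha, mul_pow]
          ring
      _ ≤ M * (Λ ^ N * √(N ! : ℝ)) := h3
      _ ≤ M * ((Λ + 1) ^ N * √(N ! : ℝ)) := by gcongr
      _ = _ := by ring
  have h6 := le_of_mul_le_mul_right h5 (by positivity)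
  rw [div_mul_eq_mul_div, le_div_iff₀ hK0]
  exact h6

/-! ## Dimension one -/

theorem sphericalHarmonics_one_eq_zero {k : ℕ} (hk : 2 ≤ k) {H : MvPolynomial (Fin 1) ℂ}
    (hH : H ∈ sphericalHarmonics 1 k) : H = 0 := by
  obtain ⟨h1, h2⟩ := mem_sphericalHarmonics.1 hH
  have e1 := sum_X_mul_pderiv' h1
  have e2 := sum_X_mul_pderiv' (h1.pderiv (i := 0))
  rw [polyLaplacian_apply] at h2
  simp only [Finset.univ_unique, Finset.sum_singleton, Fin.default_eq_zero] at e1 e2 h2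
  rw [h2, mul_zero] at e2
  have hk1 : ((k - 1 : ℕ) : MvPolynomial (Fin 1) ℂ) ≠ 0 := by
    exact_mod_cast (by omega : k - 1 ≠ 0)
  have hk0 : (k : MvPolynomial (Fin 1) ℂ) ≠ 0 := by
    exact_mod_cast (by omega : k ≠ 0)
  have h3 := (mul_eq_zero.1 e2.symm).resolve_left hk1
  rw [h3, mul_zero] at e1
  exact (mul_eq_zero.1 e1.symm).resolve_left hk0

/-- In dimension one the numbers of degree at least 2 may grow arbitrarily, but they multiply zonal
polynomials that vanish; replacing them by 0 changes neither the kernel terms nor the eigenvalue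
relations. -/
theorem exists_slowGrowth {m : ℕ} (hm : 1 ≤ m) {T : 𝓢(E m, ℂ) →ₗ[ℂ] 𝓢(E m, ℂ)}
    (hT : HelmholtzRelations T) {μ : ℕ → ℂ}
    (hμ : ∀ k, ∀ H ∈ sphericalHarmonics m k, T (polyGaussian m H) = μ k • polyGaussian m H) :
    ∃ ν : ℕ → ℂ, SlowGrowth ν ∧ (∀ x y, kernelTerm m μ x y = kernelTerm m ν x y) ∧
      ∀ k, ∀ H ∈ sphericalHarmonics m k, T (polyGaussian m H) = ν k • polyGaussian m H := by
  rcases Nat.lt_or_ge m 2 with h | h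
  · obtain rfl : m = 1 := by omega
    refine ⟨fun k => if k < 2 then μ k else 0, fun b hb => ?_, fun x y => ?_, fun k H hH => ?_⟩
    · refine ⟨‖μ 0‖ + ‖μ 1‖ * b, fun k => ?_⟩
      have h0 : 0 ≤ ‖μ 0‖ := norm_nonneg _
      have h1 : 0 ≤ ‖μ 1‖ * b := by positivity
      rcases k with _ | _ | k
      · simpa using h1
      · simp
      · simp only [show ¬(k + 1 + 1 < 2) by omega, if_false, norm_zero, zero_mul]
        positivity
    · funext k
      rw [kernelTerm_eq hm, kernelTerm_eq hm]
      split_ifs with hk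
      · rfl
      · rw [sphericalHarmonics_one_eq_zero (by omega) (zonalPoly_mem hm k y)]
        simp
    · dsimp only
      split_ifs with hk
      · exact hμ k H hH
      · rw [sphericalHarmonics_one_eq_zero (by omega) hH]
        simp
  · exact ⟨μ, slowGrowth_of_helmholtz h hT hμ, fun _ _ => rfl, hμ⟩

end HelmholtzFourier

end

/-! ### The integral representation on Hermite functions -/

open HelmholtzFourier MeasureTheory in
theorem proposition2p2 (m : ℕ) (hm : 1 ≤ m)
    {ι : ℕ → Type*} (H : ∀ k : ℕ, Module.Basis (ι k) ℂ (sphericalHarmonics m k))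
    (T : 𝓢(E m, ℂ) →ₗ[ℂ] 𝓢(E m, ℂ)) (hT : HelmholtzRelations T)
    (μ : ℕ → ℕ → ℂ)
    (hμ : ∀ (j k : ℕ) (l : ι k), T (hermite m j k (H k l)) = μ j k • hermite m j k (H k l)) :
    (∀ x y : E m, Summable (kernelTerm m (μ 0) x y)) ∧
    ∀ (j k : ℕ) (l : ι k) (y : E m),
      Integrable (fun x : E m => kernel m (μ 0) x y * hermite m j k (H k l) x) ∧
      T (hermite m j k (H k l)) y =
        (1 / ((2 * Real.pi) ^ ((m : ℝ) / 2) : ℝ) : ℂ) *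
          ∫ x : E m, kernel m (μ 0) x y * hermite m j k (H k l) x := by
  -- The eigenvalue does not depend on the basis index, so the relation extends linearly to all
  -- harmonic polynomials, in particular to the isotropic powers used for the growth bound.
  have hμ0 : ∀ k, ∀ P ∈ sphericalHarmonics m k,
      T (polyGaussian m P) = μ 0 k • polyGaussian m P := by
    intro k P hP
    have h : T ∘ₗ polyGaussian m ∘ₗ (sphericalHarmonics m k).subtype
        = μ 0 k • (polyGaussian m ∘ₗ (sphericalHarmonics m k).subtype) := by
      refine (H k).ext fun l => ?_
      have := hμ 0 k l
      rw [hermite_zero hm] at this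
      exact this
    exact LinearMap.congr_fun h ⟨P, hP⟩
  obtain ⟨ν, hν, hker, hνT⟩ := exists_slowGrowth hm hT hμ0
  have hkernel (x y : E m) : kernel m (μ 0) x y = kernel m ν x y := by
    rw [kernel, kernel, hker]
  refine ⟨fun x y => hker x y ▸ hν.summable_kernelTerm hm x y, fun j k l y => ?_⟩
  have hH : (H k l : MvPolynomial (Fin m) ℂ) ∈ sphericalHarmonics m k := (H k l).2
  obtain ⟨a, ha⟩ := exists_hermite_eq_sum j k (H k l : MvPolynomial (Fin m) ℂ)
  have hx (x : E m) : kernel m (μ 0) x y * hermite m j k (H k l) x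
      = ∑ n ∈ Finset.range (j + 1), a n *
        (kernel m ν x y * polyGaussian m (sqNorm m ^ n * H k l) x) := by
    rw [ha, hkernel, sum_apply, Finset.mul_sum]
    refine Finset.sum_congr rfl fun n _ => ?_
    rw [smul_apply, smul_eq_mul]
    ring
  have hi (n : ℕ) := hν.integral_kernel_mul hm hH y n
  simp only [hx]
  refine ⟨integrable_finsetSum _ fun n _ => (hi n).1.const_mul _, ?_⟩
  rw [integral_finsetSum _ fun n _ => (hi n).1.const_mul _, ha, map_sum, sum_apply, Finset.mul_sum]
  refine Finset.sum_congr rfl fun n _ => ?_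
  rw [integral_const_mul, mul_left_comm, (hi n).2, map_smul, smul_apply, smul_eq_mul,
    map_polyGaussian_sqNorm_pow hm hT hH (hνT k _ hH), smul_apply, smul_eq_mul]
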